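/- A Euclidean Jordan algebra is a finite-dimensional real commutative (not necessarily associative) algebra $(V,\bullet)$ with unit $u$ satisfying $x^2\bullet(y\bullet x)=(x^2\bullet y)\bullet x$ for all $x,y$, which admits an inner product $(\cdot|\cdot)$ with $(x\bullet y|z)=(y|x\bullet z)$ for all $x,y,z$. Let $V$ be such an algebra, let $V_+=\{x^2: x\in V\}$, write $x\le y$ if $y-x\in V_+$, and let $\|x\|_u=\inf\{t\ge 0: -tu\le x\le tu\}$ be the order-unit (spectral) norm. For $y\in V$ let $h_y(z)=\|z-y\|_u-\|y\|_u$ $(z\in V)$. The horofunctions of $(V,\|\cdot\|_u)$ with basepoint $0$ are the elements of $\overline{\{h_y:y\in V\}}\setminus\{h_y:y\in V\}$, the closure being taken in $\mathbb{R}^V$ with the topology of pointwise convergence. A horofunction $h$ is a Busemann point if there are a net $(x^a)$ in $V$ and a $w\in V$ such that $h_{x^a}\to h$ pointwise and, for every $\varepsilon>0$, there is an index $\beta$ with $\|x^a-x^{a'}\|_u+\|x^{a'}-w\|_u-\|x^a-w\|_u<\varepsilon$ for all $a\ge a'\ge\beta$. A Jordan frame $p_1,\dots,p_r$ is a family of pairwise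 orthogonal ($p_i\bullet p_j=0$ for $i\ne j$) primitive idempotents with $p_1+\dots+p_r=u$; an idempotent is primitive if it is non-zero and is not a sum of two non-zero idempotents. For $I\subseteq\{1,\dots,r\}$ put $p_I=\sum_{i\in I}p_i$, let $U_x y=2x\bullet(x\bullet y)-x^2\bullet y$, and let $V(p_I)=U_{p_I}(V)$, a subalgebra with unit $p_I$. For $I\neq\emptyset$ and $z\in V(p_I)$, let $\Lambda_{V(p_I)}(z)$ be the maximal eigenvalue of $z$ in $V(p_I)$, i.e. $\inf\{t\in\mathbb{R}: tp_I-z=y^2\text{ for some }y\in V(p_I)\}$. **Theorem.** Let $p_1,\dots,p_r$ be a Jordan frame of $V$, let $I,J\subseteq\{1,\dots,r\}$ with $I\cap J=\emptyset$ and $I\cup J\ne\emptyset$, and let $\alpha\in\mathbb{R}^{I\cup J}$ with $\min\{\alpha_i: i\in I\cup J\}=0$. Then the function $h\colon V\to\mathbb{R}$, $$h(x)=\max\Big\{\Lambda_{V(p_I)}\Big(-U_{p_I}x-\sum_{i\in I}\alpha_ip_i\Big),\ \Lambda_{V(p_J)}\Big(U_{p_J}x-\sum_{j\in J}\alpha_jp_j\Big)\Big\},$$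 where the corresponding term is omitted from the maximum if $I$ or $J$ is empty, is a horofunction of $(V,\|\cdot\|_u)$ with basepoint $0$. Conversely, every horofunction of $(V,\|\cdot\|_u)$ with basepoint $0$ is of this form for some such Jordan frame, $I$, $J$ and $\alpha$, and every horofunction is a Busemann point. -/

import Mathlib

open Filter Topology

/-! ### Horofunctions and Busemann points of a distance `d` on `M`, with basepoint `b` -/

namespace Horo

universe u

variable {M : Type u}

/-- The internal metric functional `h_y(z) = d(z, y) - d(b, y)`. -/
def internalPoint (d : M → M → ℝ) (b y : M) : M → ℝ :=
  fun z => d z y - d b y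

/-- The horofunction compactification: the closure of the internal points in the space of all
real functions on `M` with the topology of pointwise convergence (the product topology). -/
def compactification (d : M → M → ℝ) (b : M) : Set (M → ℝ) :=
  closure (Set.range (internalPoint d b))

/-- The horofunction boundary; its elements are the horofunctions. -/
def boundary (d : M → M → ℝ) (b : M) : Set (M → ℝ) :=
  compactification d b \ Set.range (internalPoint d b)

/-- Almost geodesic nets. -/
def IsAlmostGeodesic (d : M → M → ℝ) {ι : Type*} [Preorder ι] (x : ι → M) : Prop :=
  ∃ w : M, ∀ ε : ℝ, 0 < ε → ∃ β : ι, ∀ a a' : ι, β ≤ a' → a' ≤ a →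
    d (x a) (x a') + d (x a') w - d (x a) w < ε

/-- A Busemann point is a horofunction which is the pointwise limit of the internal points along
an almost geodesic net (indexed by a nonempty directed set). -/
def IsBusemannPoint (d : M → M → ℝ) (b : M) (h : M → ℝ) : Prop :=
  h ∈ boundary d b ∧
    ∃ (ι : Type u) (_ : Preorder ι) (_ : Nonempty ι) (_ : IsDirected ι (· ≤ ·)) (x : ι → M),
      IsAlmostGeodesic d x ∧
        ∀ z : M, Tendsto (fun a => d z (x a) - d b (x a)) atTop (𝓝 (h z))

end Horo

/-! ### Euclidean Jordan algebras -/

namespace EJA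

/-- A real commutative, not necessarily associative algebra with unit is a Euclidean Jordan
algebra if it is finite dimensional, satisfies the Jordan identity, and carries an inner product
for which all multiplication operators are self-adjoint. -/
structure IsEuclideanJordanAlgebra (V : Type*) [NonAssocCommRing V] [Module ℝ V] : Prop where
  finiteDimensional : FiniteDimensional ℝ V
  jordan : IsCommJordan V
  exists_inner : ∃ B : LinearMap.BilinForm ℝ V,
    (∀ x y, B x y = B y x) ∧ (∀ x, x ≠ 0 → 0 < B x x) ∧ ∀ x y z, B (x * y) z = B y (x * z)

variable {V : Type*} [NonAssocCommRing V] [Module ℝ V]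

/-- The cone of squares `V₊ = {x² : x ∈ V}`. -/
def cone (V : Type*) [NonAssocCommRing V] : Set V :=
  {x | ∃ y : V, x = y * y}

/-- The order-unit norm `‖x‖_u = inf {t ≥ 0 : -t u ≤ x ≤ t u}`, where `u = 1` is the unit of `V`
and `x ≤ y` means `y - x ∈ V₊`. -/
noncomputable def orderUnitNorm (x : V) : ℝ :=
  sInf {t : ℝ | 0 ≤ t ∧ x - -(t • (1 : V)) ∈ cone V ∧ t • (1 : V) - x ∈ cone V}

/-- The distance of the order-unit norm. -/
noncomputable def spectralDist (x y : V) : ℝ :=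
  orderUnitNorm (x - y)

/-- A primitive idempotent: a nonzero idempotent that is not the sum of two nonzero idempotents. -/
def IsPrimitiveIdempotent (p : V) : Prop :=
  p * p = p ∧ p ≠ 0 ∧ ¬ ∃ a b : V, a * a = a ∧ b * b = b ∧ a ≠ 0 ∧ b ≠ 0 ∧ p = a + b

/-- A Jordan frame: mutually orthogonal primitive idempotents whose sum is the unit. -/
structure IsJordanFrame {r : ℕ} (p : Fin r → V) : Prop where
  primitive : ∀ i, IsPrimitiveIdempotent (p i)
  orthogonal : ∀ i j, i ≠ j → p i * p j = 0
  sum_eq_one : ∑ i, p i = 1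

/-- The idempotent `p_I = ∑_{i ∈ I} p_i`. -/
def frameSum {r : ℕ} (p : Fin r → V) (I : Finset (Fin r)) : V :=
  ∑ i ∈ I, p i

variable [SMulCommClass ℝ V V] [IsScalarTower ℝ V V]

/-- The quadratic representation `U_x y = 2 x(xy) - x² y`. -/
noncomputable def quadRep (x : V) : V →ₗ[ℝ] V :=
  (2 : ℝ) • (LinearMap.mulLeft ℝ x ∘ₗ LinearMap.mulLeft ℝ x) - LinearMap.mulLeft ℝ (x * x)

/-- The subalgebra `V(e) = U_e(V)` of an idempotent `e`; its unit is `e`. -/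
noncomputable def corner (e : V) : Submodule ℝ V :=
  LinearMap.range (quadRep e)

/-- `Λ_{V(e)}(z) = inf {t : z ≤ t e}` for `z ∈ V(e)`, where the order is that of the cone of
squares of the algebra `V(e)`, whose unit is `e`. This is the largest eigenvalue of `z` in `V(e)`
(for `e ≠ 0`). -/
noncomputable def maxEigenvalue (e z : V) : ℝ :=
  sInf {t : ℝ | ∃ y ∈ corner e, t • e - z = y * y}

/-- The term `Λ_{V(p_I)}(-U_{p_I} x - ∑_{i ∈ I} α_i p_i)`. -/
noncomputable def negTerm {r : ℕ} (p : Fin r → V) (I : Finset (Fin r)) (α : Fin r → ℝ)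
    (x : V) : ℝ :=
  maxEigenvalue (frameSum p I) (-(quadRep (frameSum p I) x) - ∑ i ∈ I, α i • p i)

/-- The term `Λ_{V(p_J)}(U_{p_J} x - ∑_{j ∈ J} α_j p_j)`. -/
noncomputable def posTerm {r : ℕ} (p : Fin r → V) (J : Finset (Fin r)) (α : Fin r → ℝ)
    (x : V) : ℝ :=
  maxEigenvalue (frameSum p J) (quadRep (frameSum p J) x - ∑ j ∈ J, α j • p j)

/-- The maximum of the two terms, where the term of an empty index set is omitted. Only the values
of `α` on `I ∪ J` matter; the function is used only when `I ∪ J` is nonempty. -/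
noncomputable def horoForm {r : ℕ} (p : Fin r → V) (I J : Finset (Fin r)) (α : Fin r → ℝ)
    (x : V) : ℝ :=
  if I = ∅ then posTerm p J α x
  else if J = ∅ then negTerm p I α x
  else max (negTerm p I α x) (posTerm p J α x)

end EJA

/-! Write y = ∑ c_i p_i in a Jordan frame and put ρ = ‖y‖_u = max |c_i|. Since ρ u = ∑ ρ p_i, for t
≥ -ρ the inequality ‖x - y‖_u - ρ ≤ t says that t u - x + ∑ (ρ + c_i) p_i and t u + x + ∑ (ρ - c_i)
p_i lie in the cone. Let y run along an ultrafilter with ρ → ∞. The frames converge by compactness,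
and each nonnegative number ρ ± c_i converges or tends to infinity. Positivity is tested against
squares v² (`mem_cone_iff`); a coefficient tending to infinity forces p_i v = 0 in the limit, so
only the compressions to V(p_I) and V(p_J) survive (`eventually_mem_cone`,
`eventually_notMem_cone`), and the limit is `horoForm` (`tendsto_horoForm`).

Every horofunction arises this way, because a bounded ρ produces only internal points. Conversely,
each admissible I, J, α is realised by a sequence y_n with ‖y_n‖_u = n for large n and ‖y_n - y_m‖_u
≤ n - m for m ≤ n. Such a sequence is almost geodesic, and its limit is unbounded below, unlike any
internal point.

The algebraic input is the spectral theorem, refined to Jordan frames of bounded length, and the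
fact that primitivity of an idempotent survives limits (`isPrimitiveIdempotent_iff`). -/

set_option linter.unusedSectionVars false

namespace EJA

/-- An inner product for which the multiplication operators are self-adjoint. -/
class EuclideanForm (V : Type*) [NonAssocCommRing V] [Module ℝ V] where
  /-- The inner product. -/
  core : InnerProductSpace.Core ℝ V
  core_inner_mul_left : ∀ x y z : V, core.inner (x * y) z = core.inner y (x * z)

/-! ### Peirce calculus, power associativity and the spectral theorem -/

section Algebra

variable {V : Type*} [NonAssocCommRing V] [Module ℝ V]

/-- This Euclidean norm is auxiliary: it supplies the topology and compactness, while the order-unit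
norm stays a plain function. -/
noncomputable instance [EuclideanForm V] : NormedAddCommGroup V :=
  @InnerProductSpace.Core.toNormedAddCommGroup ℝ V _ _ _ EuclideanForm.core

noncomputable instance [EuclideanForm V] : InnerProductSpace ℝ V :=
  InnerProductSpace.ofCore (EuclideanForm.core (V := V)).toCore

local notation "⟪" x "," y "⟫" => inner ℝ x y

theorem inner_mul_left [EuclideanForm V] (x y z : V) : ⟪x * y, z⟫ = ⟪y, x * z⟫ :=
  EuclideanForm.core_inner_mul_left x y z

theorem inner_mul_right [EuclideanForm V] (x y z : V) : ⟪x * y, z⟫ = ⟪x, y * z⟫ := by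
  rw [mul_comm, inner_mul_left]

section Jordan

variable [IsCommJordan V]

theorem linearized_jordan (a b c d : V) :
    a * ((b * c) * d) - (b * c) * (a * d) + (b * ((c * a) * d) - (c * a) * (b * d))
      + (c * ((a * b) * d) - (a * b) * (c * d)) = 0 := by
  have h := congrArg (fun f : AddMonoid.End V => f d) (two_nsmul_lie_lmul_lmul_add_add_eq_zero a b c)
  simp only [Ring.lie_def] at h
  have h2 : (2 : ℝ) • (a * ((b * c) * d) - (b * c) * (a * d) + (b * ((c * a) * d) - (c * a) * (b * d))
      + (c * ((a * b) * d) - (a * b) * (c * d))) = 0 := by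
    rw [two_smul, ← two_nsmul]
    exact h
  exact (smul_eq_zero.1 h2).resolve_left two_ne_zero

/-- The linearized Jordan identity solved for one term. Read as an operator identity in `a`, it
reduces multiplication by a triple product to multiplications by the factors and their pairwise
products. -/
theorem mul_mul_mul_formula (a b c d : V) :
    ((b * c) * d) * a = (b * c) * (d * a) + (b * d) * (c * a) + (c * d) * (b * a)
      - b * (d * (c * a)) - c * (d * (b * a)) := by
  have h := linearized_jordan a b c d
  rw [mul_comm a (b * c * d), mul_comm a d, mul_comm (c * a) d, mul_comm (c * a) (b * d),
    mul_comm (a * b) d, mul_comm (a * b) (c * d), mul_comm a b] at h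
  rw [← sub_eq_zero]
  rw [← h]
  abel

theorem peirce_one_mul {e x y : V} (he : e * e = e) (hx : e * x = x) (hy : e * y = y) :
    e * (x * y) = x * y := by
  have h := mul_mul_mul_formula y e e x
  simp only [he, hx, hy] at h
  rw [← sub_eq_zero]
  have h2 : e * (x * y) - x * y = x * y - (e * (x * y) + x * y + x * y - e * (x * y) - e * (x * y)) := by
    abel
  rw [h2, ← h, sub_self]

/-- One instance of the formula puts the product in the 1-eigenspace of `e`, the other in the
kernel. -/
theorem peirce_one_mul_zero {e x y : V} (he : e * e = e) (hx : e * x = x) (hy : e * y = 0) :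
    x * y = 0 := by
  have h := mul_mul_mul_formula y e e x
  have h' := mul_mul_mul_formula x e e y
  simp only [he, hx, hy, zero_mul, mul_zero, add_zero, sub_zero] at h h'
  rw [mul_comm y x] at h'
  have h2 : e * (x * y) = 0 := by
    have : e * (x * y) = -(e * (x * y) - e * (x * y) - e * (x * y)) := by abel
    rw [this, ← h', neg_zero]
  rw [h, h2]

/-- The minimal equation of multiplication by an idempotent. -/
theorem mul_idempotent_cubic {e : V} (he : e * e = e) (x : V) :
    e * x = (3 : ℝ) • (e * (e * x)) - (2 : ℝ) • (e * (e * (e * x))) := by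
  have h := mul_mul_mul_formula x e e e
  simp only [he] at h
  exact h.trans (by module)

end Jordan

variable [SMulCommClass ℝ V V] [IsScalarTower ℝ V V]

/-- The operator of multiplication by `x`. -/
noncomputable abbrev lmul (x : V) : Module.End ℝ V := LinearMap.mulLeft ℝ x

section Jordan

variable [IsCommJordan V]

theorem lmul_formula (b c d : V) :
    lmul ((b * c) * d) = lmul (b * c) * lmul d + lmul (b * d) * lmul c + lmul (c * d) * lmul b
      - lmul b * lmul d * lmul c - lmul c * lmul d * lmul b := by
  ext a
  simpa using mul_mul_mul_formula a b c d

/-- Two consecutive powers are carried through the induction because the operator of xⁿ⁺² is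
expressed through those of xⁿ and xⁿ⁺¹. -/
theorem commute_lmul_pow (x : V) (n : ℕ) :
    Commute (lmul ((lmul x ^ n) 1)) (lmul x) ∧ Commute (lmul ((lmul x ^ (n + 1)) 1)) (lmul x) := by
  have hsq : Commute (lmul (x * x)) (lmul x) := by
    ext a
    simp only [Module.End.mul_apply, LinearMap.mulLeft_apply]
    rw [mul_comm (x * x) (x * a), IsCommJordan.lmul_comm_rmul_rmul, mul_comm a]
  induction n with
  | zero =>
    constructor
    · ext a; simp
    · simp
  | succ n ih =>
    refine ⟨ih.2, ?_⟩
    have e : (lmul x ^ (n + 1 + 1)) 1 = (x * (lmul x ^ n) 1) * x := by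
      rw [pow_succ', pow_succ', Module.End.mul_apply, Module.End.mul_apply]
      simp [mul_comm]
    have e1 : (lmul x ^ (n + 1)) 1 = x * (lmul x ^ n) 1 := by
      rw [pow_succ', Module.End.mul_apply]; simp
    rw [e1] at ih
    rw [e, lmul_formula, mul_comm ((lmul x ^ n) 1) x]
    have r := Commute.refl (lmul x)
    exact (((((ih.2.mul_left r).add_left (hsq.mul_left ih.1)).add_left (ih.2.mul_left r)).sub_left
      ((r.mul_left r).mul_left ih.1)).sub_left ((ih.1.mul_left r).mul_left r))

theorem commute_lmul_aeval (x : V) (P Q : Polynomial ℝ) :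
    Commute (lmul (Polynomial.aeval (lmul x) P 1)) (Polynomial.aeval (lmul x) Q) := by
  have h : Commute (lmul (Polynomial.aeval (lmul x) P 1)) (lmul x) := by
    induction P using Polynomial.induction_on' with
    | add p q hp hq =>
      have : lmul ((Polynomial.aeval (lmul x) (p + q)) 1)
        = lmul ((Polynomial.aeval (lmul x) p) 1) + lmul ((Polynomial.aeval (lmul x) q) 1) := by
        ext a; simp [add_mul]
      rw [this]
      exact hp.add_left hq
    | monomial n a =>
      have : lmul (Polynomial.aeval (lmul x) (Polynomial.monomial n a) 1)
        = a • lmul ((lmul x ^ n) 1) := by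
        ext v
        simp [Polynomial.aeval_monomial, smul_mul_assoc]
      rw [this]
      exact (commute_lmul_pow x n).1.smul_left a
  induction Q using Polynomial.induction_on' with
  | add p q hp hq => rw [map_add]; exact hp.add_right hq
  | monomial n a =>
    rw [Polynomial.aeval_monomial]
    exact (Algebra.commute_algebraMap_right a _).mul_right (h.pow_right n)

/-- Power associativity: the commutation of the two operators, evaluated at the unit. -/
theorem aeval_mul_aeval (x : V) (P Q : Polynomial ℝ) :
    Polynomial.aeval (lmul x) P 1 * Polynomial.aeval (lmul x) Q 1
      = Polynomial.aeval (lmul x) (P * Q) 1 := by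
  have h := congrArg (fun f : Module.End ℝ V => f 1) (commute_lmul_aeval x P Q).eq
  simp only [Module.End.mul_apply, LinearMap.mulLeft_apply, mul_one] at h
  rw [h, mul_comm P Q, map_mul, Module.End.mul_apply]

end Jordan

/-- A symmetric operator on a finite dimensional space has enough eigenvectors to write any vector
as a sum of eigenvectors for distinct eigenvalues. -/
theorem exists_eigenvector_sum {E : Type*} [NormedAddCommGroup E] [InnerProductSpace ℝ E]
    [FiniteDimensional ℝ E] {T : E →ₗ[ℝ] E} (hT : T.IsSymmetric) (x : E) :
    ∃ f : ℝ →₀ E, (∀ μ, T (f μ) = μ • f μ) ∧ ∑ μ ∈ f.support, f μ = x := by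
  have htop : (⨆ μ, Module.End.eigenspace T μ) = ⊤ := by
    rw [← Submodule.orthogonal_eq_bot_iff]
    exact hT.orthogonalComplement_iSup_eigenspaces_eq_bot
  have hx : x ∈ ⨆ μ, Module.End.eigenspace T μ := htop ▸ Submodule.mem_top
  obtain ⟨f, hf, hs⟩ := (Submodule.mem_iSup_iff_exists_finsupp _ _).1 hx
  exact ⟨f, fun μ => Module.End.mem_eigenspace_iff.1 (hf μ), hs⟩

variable [EuclideanForm V]

theorem lmul_isSymmetric (x : V) : (lmul x).IsSymmetric := fun y z => by
  simpa using inner_mul_left x y z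

theorem aeval_apply_eigenvector {T : Module.End ℝ V} {v : V} {μ : ℝ} (h : T v = μ • v)
    (P : Polynomial ℝ) : Polynomial.aeval T P v = P.eval μ • v := by
  induction P using Polynomial.induction_on' with
  | add p q hp hq => simp [hp, hq, add_smul]
  | monomial n a =>
    have : ∀ n : ℕ, (T ^ n) v = μ ^ n • v := by
      intro n
      induction n with
      | zero => simp
      | succ n ih => rw [pow_succ', Module.End.mul_apply, ih, map_smul, h, smul_smul, pow_succ]
    simp [Polynomial.aeval_monomial, this, smul_smul, mul_comm]

variable [IsCommJordan V] [FiniteDimensional ℝ V]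

/-- The spectral theorem. -/
theorem spectral (x : V) : ∃ (S : Finset ℝ) (q : ℝ → V),
    (∀ μ ∈ S, q μ * q μ = q μ) ∧ (∀ μ ∈ S, ∀ ν ∈ S, μ ≠ ν → q μ * q ν = 0) ∧
    (∀ μ ∈ S, q μ ≠ 0) ∧ ∑ μ ∈ S, q μ = 1 ∧ ∑ μ ∈ S, μ • q μ = x ∧
    ∀ e : V, e * e = e → e * x = x → ∀ μ ∈ S, μ ≠ 0 → e * q μ = q μ := by
  obtain ⟨f, hf, hs⟩ := exists_eigenvector_sum (lmul_isSymmetric x) 1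
  have hP : ∀ P : Polynomial ℝ, Polynomial.aeval (lmul x) P 1
      = ∑ μ ∈ f.support, P.eval μ • f μ := fun P => by
    rw [← hs, map_sum]
    exact Finset.sum_congr rfl fun μ _ => aeval_apply_eigenvector (hf μ) P
  -- Lagrange polynomials exhibit each eigencomponent of the unit as a polynomial in x, so products
  -- of components are computed by `aeval_mul_aeval`.
  have hL : ∀ μ ∈ f.support, ∀ Q : Polynomial ℝ,
      Polynomial.aeval (lmul x) (Lagrange.basis f.support id μ * Q) 1 = Q.eval μ • f μ := by
    intro μ hμ Q
    rw [hP, Finset.sum_eq_single μ]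
    · rw [Polynomial.eval_mul]
      have := Lagrange.eval_basis_self (s := f.support) (v := id) (Set.injOn_id _) hμ
      simp only [id] at this
      rw [this, one_mul]
    · intro ν hν hne
      have := Lagrange.eval_basis_of_ne (s := f.support) (v := id) hne.symm hν
      simp only [id] at this
      rw [Polynomial.eval_mul, this, zero_mul, zero_smul]
    · exact fun h => absurd hμ h
  have hL1 : ∀ μ ∈ f.support, Polynomial.aeval (lmul x) (Lagrange.basis f.support id μ) 1 = f μ := by
    intro μ hμ
    simpa using hL μ hμ 1
  have hmul : ∀ μ ∈ f.support, ∀ ν ∈ f.support,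
      f μ * f ν = (Lagrange.basis f.support id ν).eval μ • f μ := by
    intro μ hμ ν hν
    conv_lhs => rw [← hL1 μ hμ, ← hL1 ν hν, aeval_mul_aeval]
    exact hL μ hμ _
  refine ⟨f.support, f, ?_, ?_, fun μ hμ => Finsupp.mem_support_iff.1 hμ, hs, ?_, ?_⟩
  · intro μ hμ
    have := Lagrange.eval_basis_self (s := f.support) (v := id) (Set.injOn_id _) hμ
    simp only [id] at this
    rw [hmul μ hμ μ hμ, this, one_smul]
  · intro μ hμ ν hν hne
    have := Lagrange.eval_basis_of_ne (s := f.support) (v := id) hne.symm hμ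
    simp only [id] at this
    rw [hmul μ hμ ν hν, this, zero_smul]
  · have h := congrArg (lmul x) hs
    rw [map_sum] at h
    simp only [hf] at h
    simpa using h
  · intro e hee he μ hμ h0
    have h1 : x * f μ = μ • f μ := hf μ
    have hinv := fun z => peirce_one_mul hee he (y := z)
    -- For μ ≠ 0 the component is μ⁻¹ times a polynomial in `lmul x` applied to x instead of 1; such
    -- elements never leave the 1-eigenspace of `e`.
    have hQ : ∀ Q : Polynomial ℝ, e * (Polynomial.aeval (lmul x) Q x)
        = Polynomial.aeval (lmul x) Q x := by
      intro Q
      induction Q using Polynomial.induction_on' with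
      | add p q hp hq => simp only [map_add, LinearMap.add_apply, mul_add, hp, hq]
      | monomial n a =>
        have : ∀ n : ℕ, e * ((lmul x ^ n) x) = (lmul x ^ n) x := by
          intro n
          induction n with
          | zero => simpa using he
          | succ n ih => rw [pow_succ', Module.End.mul_apply]; exact hinv _ ih
        simp [Polynomial.aeval_monomial, this, mul_smul_comm]
    have h2 : f μ = μ⁻¹ • Polynomial.aeval (lmul x) (Lagrange.basis f.support id μ) x := by
      have h3 : Polynomial.aeval (lmul x) (Lagrange.basis f.support id μ) x = x * f μ := by
        have h4 := aeval_mul_aeval x (Lagrange.basis f.support id μ) Polynomial.X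
        have h5 : Polynomial.aeval (lmul x) (Polynomial.X : Polynomial ℝ) 1 = x := by simp
        rw [map_mul, Module.End.mul_apply, hL1 μ hμ, h5] at h4
        rw [← h4, mul_comm]
      rw [h3, h1, smul_smul, inv_mul_cancel₀ h0, one_smul]
    rw [h2, mul_smul_comm, hQ]

end Algebra

/-! ### The cone of squares, its self-duality and the order-unit norm -/

section Order

local notation "⟪" x "," y "⟫" => inner ℝ x y

variable {V : Type*} [NonAssocCommRing V] [Module ℝ V] [SMulCommClass ℝ V V] [IsScalarTower ℝ V V]

theorem quadRep_apply (x y : V) : quadRep x y = (2 : ℝ) • (x * (x * y)) - x * x * y := by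
  simp [quadRep]

theorem quadRep_of_mul_eq {e x : V} (he : e * e = e) (hx : e * x = x) : quadRep e x = x := by
  rw [quadRep_apply, he, hx, hx]; module

section Jordan

variable [IsCommJordan V]

/-- For L = multiplication by `e`, the cubic 2L³ - 3L² + L = 0 gives L(2L² - L) = 2L² - L; hence
`quadRep e` projects onto the 1-eigenspace. -/
theorem mul_quadRep {e : V} (he : e * e = e) (x : V) : e * quadRep e x = quadRep e x := by
  rw [quadRep_apply, he, mul_sub, mul_smul_comm]
  have h := mul_idempotent_cubic he x
  have h2 : (2 : ℝ) • (e * (e * (e * x))) = (3 : ℝ) • (e * (e * x)) - e * x := by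
    rw [eq_sub_iff_add_eq, add_comm, ← eq_sub_iff_add_eq]; exact h
  rw [h2]; module

theorem mem_corner_iff {e x : V} (he : e * e = e) : x ∈ corner e ↔ e * x = x := by
  constructor
  · rintro ⟨y, rfl⟩
    exact mul_quadRep he y
  · exact fun h => ⟨x, quadRep_of_mul_eq he h⟩

end Jordan

variable [EuclideanForm V]

theorem inner_quadRep (e x y : V) : ⟪quadRep e x, y⟫ = ⟪x, quadRep e y⟫ := by
  simp only [quadRep_apply, inner_sub_left, inner_sub_right, inner_smul_left, inner_smul_right,
    inner_mul_left, RCLike.conj_to_real]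

theorem inner_one_mul_self (v : V) : ⟪(1 : V), v * v⟫ = ‖v‖ ^ 2 := by
  rw [← inner_mul_right, one_mul, real_inner_self_eq_norm_sq]

theorem inner_idempotent {e q : V} (hq : q * q = q) (h : e * q = q) : ⟪e, q⟫ = ‖q‖ ^ 2 := by
  rw [← real_inner_self_eq_norm_sq]
  conv_lhs => rw [← hq, ← inner_mul_right, h]

section Jordan

variable [IsCommJordan V]

/-- The only possible eigenvalues of multiplication by `e` are 0, 1/2 and 1, and there λ = λ² + 4(λ
- λ²)². This gives positivity and identifies the null vectors without a Peirce decomposition. -/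
theorem inner_idempotent_mul {e : V} (he : e * e = e) (x : V) :
    ⟪e * x, x⟫ = ‖e * x‖ ^ 2 + 4 * ‖e * x - e * (e * x)‖ ^ 2 := by
  have h1 := congrArg (fun z => ⟪z, x⟫) (mul_idempotent_cubic he x)
  have h2 := congrArg (fun z => ⟪z, x⟫) (mul_idempotent_cubic he (e * x))
  simp only [inner_sub_left, inner_smul_left, RCLike.conj_to_real] at h1 h2
  rw [← real_inner_self_eq_norm_sq, ← real_inner_self_eq_norm_sq]
  simp only [inner_sub_left, inner_sub_right]
  simp only [inner_mul_left] at h1 h2 ⊢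
  linarith

theorem inner_idempotent_mul_nonneg {e : V} (he : e * e = e) (x : V) : 0 ≤ ⟪e * x, x⟫ := by
  rw [inner_idempotent_mul he]; positivity

theorem inner_idempotent_sq_nonneg {e : V} (he : e * e = e) (x : V) : 0 ≤ ⟪e, x * x⟫ := by
  rw [← inner_mul_right]; exact inner_idempotent_mul_nonneg he x

theorem mul_eq_zero_of_inner_sq {e x : V} (he : e * e = e) (h : ⟪e, x * x⟫ = 0) : e * x = 0 := by
  rw [← inner_mul_right, inner_idempotent_mul he] at h
  have : ‖e * x‖ ^ 2 = 0 := by nlinarith [sq_nonneg ‖e * x‖, sq_nonneg ‖e * x - e * (e * x)‖]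
  simpa using this

/-- Sums of orthogonal idempotents multiply diagonally. -/
theorem sum_smul_mul_sum_smul {ι : Type*} {S : Finset ι} {q : ι → V}
    (hq : ∀ i ∈ S, q i * q i = q i) (ho : ∀ i ∈ S, ∀ j ∈ S, i ≠ j → q i * q j = 0)
    (a b : ι → ℝ) :
    (∑ i ∈ S, a i • q i) * (∑ i ∈ S, b i • q i) = ∑ i ∈ S, (a i * b i) • q i := by
  rw [Finset.sum_mul_sum]
  refine Finset.sum_congr rfl fun i hi => ?_
  rw [Finset.sum_eq_single i]
  · rw [smul_mul_assoc, mul_smul_comm, hq i hi, smul_smul]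
  · intro j hj hne
    rw [smul_mul_assoc, mul_smul_comm, ho i hi j hj hne.symm, smul_zero, smul_zero]
  · exact fun h => absurd hi h

variable [FiniteDimensional ℝ V]

/-- An element of `V(e)` is the square of an element of `V(e)`, or is negative on some
idempotent of `V(e)`. -/
theorem sq_or_exists_idempotent {e z : V} (he : e * e = e) (hz : e * z = z) :
    (∃ y ∈ corner e, z = y * y) ∨ ∃ q : V, q * q = q ∧ e * q = q ∧ ⟪z, q⟫ < 0 := by
  obtain ⟨S, q, hq, ho, hne, h1, hs, hc⟩ := spectral z
  by_cases h : ∀ μ ∈ S, 0 ≤ μ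
  · left
    refine ⟨∑ μ ∈ S, √μ • q μ, ?_, ?_⟩
    · refine Submodule.sum_mem _ fun μ hμ => ?_
      -- The idempotent of the eigenvalue 0 need not lie in V(e), but its coefficient vanishes.
      by_cases h0 : μ = 0
      · simp [h0]
      · exact Submodule.smul_mem _ _ ((mem_corner_iff he).2 (hc e he hz μ hμ h0))
    · rw [sum_smul_mul_sum_smul hq ho, ← hs]
      exact Finset.sum_congr rfl fun μ hμ => by rw [Real.mul_self_sqrt (h μ hμ)]
  · right
    push Not at h
    obtain ⟨μ, hμ, hlt⟩ := h
    refine ⟨q μ, hq μ hμ, hc e he hz μ hμ hlt.ne, ?_⟩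
    have : z * q μ = μ • q μ := by
      have h2 := sum_smul_mul_sum_smul hq ho (fun ν => ν) (fun ν => if ν = μ then 1 else 0)
      simpa [hs, hμ] using h2
    rw [← hq μ hμ, ← inner_mul_right, this, inner_smul_left, real_inner_self_eq_norm_sq]
    have := norm_pos_iff.2 (hne μ hμ)
    simp only [RCLike.conj_to_real]
    exact mul_neg_of_neg_of_pos hlt (by positivity)

theorem exists_sqrt_mul_self (y : V) : ∃ (S : Finset ℝ) (q : ℝ → V), (∀ μ ∈ S, q μ * q μ = q μ) ∧
    y * y = ∑ μ ∈ S, (μ * μ) • q μ := by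
  obtain ⟨S, q, hq, ho, hne, h1, hs, hc⟩ := spectral y
  refine ⟨S, q, hq, ?_⟩
  rw [← sum_smul_mul_sum_smul hq ho, hs]

/-- The cone of squares is self-dual. -/
theorem mem_cone_iff {x : V} : x ∈ cone V ↔ ∀ v : V, 0 ≤ ⟪x, v * v⟫ := by
  constructor
  · rintro ⟨y, rfl⟩ v
    obtain ⟨S, q, hq, h⟩ := exists_sqrt_mul_self y
    rw [h, sum_inner]
    refine Finset.sum_nonneg fun μ hμ => ?_
    rw [inner_smul_left]
    exact mul_nonneg (mul_self_nonneg μ) (inner_idempotent_sq_nonneg (hq μ hμ) v)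
  · intro h
    rcases sq_or_exists_idempotent (one_mul (1 : V)) (one_mul x) with ⟨y, -, hy⟩ | ⟨q, hq, -, hlt⟩
    · exact ⟨y, hy⟩
    · have := h q
      rw [hq] at this
      linarith

/-- Unit test vectors allow limits to be taken by compactness of the sphere. -/
theorem mem_cone_iff_unit {x : V} : x ∈ cone V ↔ ∀ v : V, ‖v‖ = 1 → 0 ≤ ⟪x, v * v⟫ := by
  refine mem_cone_iff.trans ⟨fun h v _ => h v, fun h v => ?_⟩
  by_cases hv : v = 0
  · simp [hv]
  · have h2 := h (‖v‖⁻¹ • v) (by rw [norm_smul, norm_inv, norm_norm, inv_mul_cancel₀ (by simpa)])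
    rw [smul_mul_assoc, mul_smul_comm, smul_smul, inner_smul_right] at h2
    have : 0 < ‖v‖⁻¹ * ‖v‖⁻¹ := by have := norm_pos_iff.2 hv; positivity
    exact nonneg_of_mul_nonneg_right h2 this

theorem exists_corner_sq_iff {e z : V} (he : e * e = e) (hz : e * z = z) :
    (∃ y ∈ corner e, z = y * y) ↔ z ∈ cone V := by
  constructor
  · rintro ⟨y, -, h⟩; exact ⟨y, h⟩
  · intro h
    rcases sq_or_exists_idempotent he hz with h' | ⟨q, hq, -, hlt⟩
    · exact h'
    · have := mem_cone_iff.1 h q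
      rw [hq] at this
      linarith

theorem add_mem_cone {x y : V} (hx : x ∈ cone V) (hy : y ∈ cone V) : x + y ∈ cone V := by
  rw [mem_cone_iff] at *
  intro v
  rw [inner_add_left]
  exact add_nonneg (hx v) (hy v)

theorem smul_mem_cone {x : V} {c : ℝ} (hc : 0 ≤ c) (hx : x ∈ cone V) : c • x ∈ cone V := by
  rw [mem_cone_iff] at *
  intro v
  rw [inner_smul_left]
  exact mul_nonneg hc (hx v)

theorem idempotent_mem_cone {e : V} (he : e * e = e) : e ∈ cone V := ⟨e, he.symm⟩

theorem sum_mem_cone {ι : Type*} {S : Finset ι} {q : ι → V} (h : ∀ i ∈ S, q i ∈ cone V) :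
    ∑ i ∈ S, q i ∈ cone V := by
  rw [mem_cone_iff]
  intro v
  rw [sum_inner]
  exact Finset.sum_nonneg fun i hi => mem_cone_iff.1 (h i hi) v

theorem isClosed_smul_sub_mem_cone (e z : V) : IsClosed {t : ℝ | t • e - z ∈ cone V} := by
  simp only [mem_cone_iff, inner_sub_left, inner_smul_left, Set.ofPred_forall, RCLike.conj_to_real]
  exact isClosed_iInter fun v => isClosed_le continuous_const (by fun_prop)

instance : ContinuousMul V where
  continuous_mul := by
    let B := (LinearMap.mul ℝ V).toContinuousBilinearMap
    exact B.continuous₂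

theorem exists_norm_mul_le : ∃ C : ℝ, 0 < C ∧ ∀ x y : V, ‖x * y‖ ≤ C * ‖x‖ * ‖y‖ := by
  obtain ⟨C, hC⟩ := ((isCompact_closedBall (0 : V) 1).prod
    (isCompact_closedBall (0 : V) 1)).exists_bound_of_continuousOn
    (f := fun z : V × V => z.1 * z.2) continuous_mul.continuousOn
  have hunit : ∀ x : V, x ≠ 0 → ‖‖x‖⁻¹ • x‖ ≤ 1 := fun x hx => by
    rw [norm_smul, norm_inv, norm_norm, inv_mul_cancel₀ (norm_ne_zero_iff.2 hx)]
  refine ⟨|C| + 1, by positivity, fun x y => ?_⟩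
  by_cases hx : x = 0
  · simp [hx]
  by_cases hy : y = 0
  · simp [hy]
  have h := hC (‖x‖⁻¹ • x, ‖y‖⁻¹ • y) ⟨by simpa using hunit x hx, by simpa using hunit y hy⟩
  simp only [smul_mul_assoc, mul_smul_comm, norm_smul, norm_inv, norm_norm] at h
  have hx' := norm_pos_iff.2 hx
  have hy' := norm_pos_iff.2 hy
  calc ‖x * y‖ = (‖x‖⁻¹ * (‖y‖⁻¹ * ‖x * y‖)) * (‖x‖ * ‖y‖) := by field_simp
    _ ≤ (|C| + 1) * (‖x‖ * ‖y‖) := by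
      gcongr
      linarith [le_abs_self C]
    _ = _ := by ring

/-- Testing against unit vectors suffices: there the unit contributes ⟪1, v²⟫ = ‖v‖² = 1, while ⟪x,
v²⟫ ≤ C‖x‖. -/
theorem exists_smul_one_sub_mem_cone :
    ∃ C : ℝ, 0 < C ∧ ∀ (x : V) (t : ℝ), C * ‖x‖ ≤ t → t • (1 : V) - x ∈ cone V := by
  obtain ⟨C, hC, h⟩ := exists_norm_mul_le (V := V)
  refine ⟨C, hC, fun x t ht => mem_cone_iff_unit.2 fun v hv => ?_⟩
  rw [inner_sub_left, inner_smul_left, inner_one_mul_self, hv]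
  have h1 := real_inner_le_norm x (v * v)
  have h2 := h v v
  rw [hv] at h2
  have h3 : ‖x‖ * ‖v * v‖ ≤ ‖x‖ * (C * 1 * 1) := by gcongr
  simp only [RCLike.conj_to_real]
  linarith

theorem smul_sub_mem_cone_mono {e z : V} (he : e * e = e) {s t : ℝ} (hst : s ≤ t)
    (h : s • e - z ∈ cone V) : t • e - z ∈ cone V := by
  have : t • e - z = (t - s) • e + (s • e - z) := by module
  rw [this]
  exact add_mem_cone (smul_mem_cone (sub_nonneg.2 hst) (idempotent_mem_cone he)) h

/-- The infimum is attained: the set is closed, is bounded below by pairing with `e`, and is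
nonempty because the unit dominates. -/
theorem maxEigenvalue_le_iff {e z : V} (he : e * e = e) (h0 : e ≠ 0) (hz : e * z = z) {t : ℝ} :
    maxEigenvalue e z ≤ t ↔ t • e - z ∈ cone V := by
  have hset : {t : ℝ | ∃ y ∈ corner e, t • e - z = y * y} = {t : ℝ | t • e - z ∈ cone V} := by
    ext t
    exact exists_corner_sq_iff he (by rw [mul_sub, mul_smul_comm, he, hz])
  have hbdd : BddBelow {t : ℝ | t • e - z ∈ cone V} := by
    refine ⟨⟪z, e⟫ / ‖e‖ ^ 2, fun t ht => ?_⟩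
    have h1 := mem_cone_iff.1 ht e
    rw [he, inner_sub_left, inner_smul_left, real_inner_self_eq_norm_sq] at h1
    have := norm_pos_iff.2 h0
    rw [div_le_iff₀ (by positivity)]
    simp only [RCLike.conj_to_real] at h1
    linarith
  have hne : {t : ℝ | t • e - z ∈ cone V}.Nonempty := by
    obtain ⟨C, -, hC⟩ := exists_smul_one_sub_mem_cone (V := V)
    refine ⟨C * ‖z‖, ?_⟩
    have hz' : e * ((C * ‖z‖) • e - z) = (C * ‖z‖) • e - z := by
      rw [mul_sub, mul_smul_comm, he, hz]
    -- Idempotents of V(e) do not distinguish `e` from 1, so domination by a multiple of 1 becomes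
    -- domination by a multiple of `e`.
    rcases sq_or_exists_idempotent he hz' with ⟨y, -, h⟩ | ⟨q, hq, heq, hlt⟩
    · exact ⟨y, h⟩
    · have h := mem_cone_iff.1 (hC z _ le_rfl) q
      have h1 : ⟪(1 : V), q⟫ = ⟪e, q⟫ := by
        conv_lhs => rw [← heq, ← inner_mul_right, one_mul]
      rw [hq, inner_sub_left, inner_smul_left, h1, ← inner_smul_left, ← inner_sub_left] at h
      linarith
  rw [maxEigenvalue, hset]
  refine ⟨fun h => smul_sub_mem_cone_mono he h ?_, fun h => csInf_le hbdd h⟩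
  exact (isClosed_smul_sub_mem_cone e z).csInf_mem hne hbdd

theorem orderUnitNorm_le_iff {x : V} {t : ℝ} : orderUnitNorm x ≤ t ↔
    0 ≤ t ∧ t • (1 : V) - x ∈ cone V ∧ t • (1 : V) + x ∈ cone V := by
  have hset : {t : ℝ | 0 ≤ t ∧ x - -(t • (1 : V)) ∈ cone V ∧ t • (1 : V) - x ∈ cone V} =
      {t : ℝ | 0 ≤ t} ∩ ({t : ℝ | t • (1 : V) - x ∈ cone V} ∩
        {t : ℝ | t • (1 : V) - (-x) ∈ cone V}) := by
    ext t
    simp only [Set.mem_ofPred_eq, Set.mem_inter_iff, sub_neg_eq_add, add_comm x]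
    tauto
  have hbdd : BddBelow {t : ℝ | 0 ≤ t ∧ x - -(t • (1 : V)) ∈ cone V ∧ t • (1 : V) - x ∈ cone V} :=
    ⟨0, fun t h => h.1⟩
  have hclosed : IsClosed {t : ℝ | 0 ≤ t ∧ x - -(t • (1 : V)) ∈ cone V ∧
      t • (1 : V) - x ∈ cone V} := by
    rw [hset]
    exact isClosed_Ici.inter ((isClosed_smul_sub_mem_cone _ _).inter (isClosed_smul_sub_mem_cone _ _))
  have hne : {t : ℝ | 0 ≤ t ∧ x - -(t • (1 : V)) ∈ cone V ∧ t • (1 : V) - x ∈ cone V}.Nonempty := by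
    obtain ⟨C, hC0, hC⟩ := exists_smul_one_sub_mem_cone (V := V)
    rw [hset]
    exact ⟨C * ‖x‖, by simp only [Set.mem_ofPred_eq]; positivity, hC x _ le_rfl,
      hC (-x) _ (by rw [norm_neg])⟩
  constructor
  · intro h
    have hm := hclosed.csInf_mem hne hbdd
    rw [hset] at hm
    refine ⟨hm.1.trans ?_, ?_, ?_⟩
    · rw [← hset]; exact h
    · refine smul_sub_mem_cone_mono (one_mul 1) ?_ hm.2.1
      rw [← hset]; exact h
    · rw [← sub_neg_eq_add]
      refine smul_sub_mem_cone_mono (one_mul 1) ?_ hm.2.2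
      rw [← hset]; exact h
  · rintro ⟨h0, h1, h2⟩
    refine csInf_le hbdd ?_
    rw [hset]
    exact ⟨h0, h1, by rw [← sub_neg_eq_add] at h2; exact h2⟩

end Jordan

end Order

/-! ### Jordan frames: existence, compactness and limits -/

section Frames

local notation "⟪" x "," y "⟫" => inner ℝ x y

variable {V : Type*} [NonAssocCommRing V] [Module ℝ V] [SMulCommClass ℝ V V] [IsScalarTower ℝ V V]
  {r : ℕ} {p : Fin r → V}

theorem IsJordanFrame.idem (hp : IsJordanFrame p) (i : Fin r) : p i * p i = p i :=
  (hp.primitive i).1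

theorem IsJordanFrame.ne_zero (hp : IsJordanFrame p) (i : Fin r) : p i ≠ 0 :=
  (hp.primitive i).2.1

theorem IsJordanFrame.frameSum_mul (hp : IsJordanFrame p) (I : Finset (Fin r)) (i : Fin r) :
    frameSum p I * p i = if i ∈ I then p i else 0 := by
  rw [frameSum, Finset.sum_mul]
  have : ∀ j ∈ I, p j * p i = if j = i then p i else 0 := by
    intro j _
    split_ifs with h
    · rw [h, hp.idem]
    · exact hp.orthogonal j i h
  rw [Finset.sum_congr rfl this, Finset.sum_ite_eq']

theorem IsJordanFrame.frameSum_mul_sum (hp : IsJordanFrame p) (I : Finset (Fin r))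
    (c : Fin r → ℝ) : frameSum p I * ∑ i ∈ I, c i • p i = ∑ i ∈ I, c i • p i := by
  rw [Finset.mul_sum]
  exact Finset.sum_congr rfl fun i hi => by rw [mul_smul_comm, hp.frameSum_mul, if_pos hi]

theorem IsJordanFrame.frameSum_idem (hp : IsJordanFrame p) (I : Finset (Fin r)) :
    frameSum p I * frameSum p I = frameSum p I := by
  have := hp.frameSum_mul_sum I fun _ => 1
  simpa [frameSum] using this

theorem IsJordanFrame.frameSum_mul_frameSum (hp : IsJordanFrame p) {I J : Finset (Fin r)}
    (hIJ : Disjoint I J) : frameSum p I * frameSum p J = 0 := by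
  rw [frameSum.eq_1 p J, Finset.mul_sum]
  refine Finset.sum_eq_zero fun i hi => ?_
  rw [hp.frameSum_mul, if_neg fun h => Finset.disjoint_left.1 hIJ h hi]

section Jordan

variable [IsCommJordan V]

theorem IsJordanFrame.mul_eq_zero (hp : IsJordanFrame p) {I : Finset (Fin r)} {x : V}
    (hx : frameSum p I * x = x) {i : Fin r} (hi : i ∉ I) : p i * x = 0 := by
  rw [mul_comm]
  exact peirce_one_mul_zero (hp.frameSum_idem I) hx (by rw [hp.frameSum_mul, if_neg hi])

theorem IsJordanFrame.frameSum_mul_of_forall (hp : IsJordanFrame p) {I : Finset (Fin r)} {x : V}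
    (hx : ∀ i ∉ I, p i * x = 0) : frameSum p I * x = x := by
  conv_rhs => rw [← one_mul x, ← hp.sum_eq_one, Finset.sum_mul]
  rw [frameSum, Finset.sum_mul]
  exact Finset.sum_subset (Finset.subset_univ I) fun i _ hi => hx i hi

end Jordan

variable [EuclideanForm V] [IsCommJordan V]

theorem inner_eq_zero_of_mul_eq_zero {x y : V} (hx : x * x = x) (h : x * y = 0) : ⟪x, y⟫ = 0 := by
  rw [← hx, inner_mul_left, h, inner_zero_right]

theorem norm_idempotent_le {e : V} (he : e * e = e) : ‖e‖ ≤ ‖(1 : V)‖ := by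
  have h := inner_idempotent he (one_mul e)
  have h2 := real_inner_le_norm 1 e
  rw [h, sq] at h2
  by_cases h0 : e = 0
  · simp [h0]
  · exact le_of_mul_le_mul_right h2 (norm_pos_iff.2 h0)

theorem IsJordanFrame.frameSum_ne_zero (hp : IsJordanFrame p) {I : Finset (Fin r)}
    (hI : I.Nonempty) : frameSum p I ≠ 0 := by
  obtain ⟨i, hi⟩ := hI
  intro h
  have := hp.frameSum_mul I i
  rw [h, zero_mul, if_pos hi] at this
  exact hp.ne_zero i this.symm

variable [FiniteDimensional ℝ V]

/-- Primitivity means V(p) = ℝp: a spectral idempotent of U_p x with nonzero eigenvalue lies under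
p, hence equals p. The last condition is a continuous identity in p, so it passes to limits. -/
theorem isPrimitiveIdempotent_iff {p : V} : IsPrimitiveIdempotent p ↔
    p * p = p ∧ p ≠ 0 ∧ ∀ x, ‖p‖ ^ 2 • quadRep p x = ⟪x, p⟫ • p := by
  constructor
  · rintro ⟨hp, h0, hprim⟩
    refine ⟨hp, h0, fun x => ?_⟩
    obtain ⟨S, q, hq, ho, hne, h1, hs, hc⟩ := spectral (quadRep p x)
    have hqp : ∀ μ ∈ S, μ • q μ = μ • p := by
      intro μ hμ
      by_cases hμ0 : μ = 0
      · simp [hμ0]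
      have hpq := hc p hp (mul_quadRep hp x) μ hμ hμ0
      by_contra hcon
      refine hprim ⟨q μ, p - q μ, hq μ hμ, ?_, hne μ hμ, ?_, by abel⟩
      · rw [mul_sub, sub_mul, sub_mul, hp, hpq, mul_comm (q μ) p, hpq, hq μ hμ]
        abel
      · intro h
        rw [sub_eq_zero.1 h] at hcon
        exact hcon rfl
    have hy : quadRep p x = (∑ μ ∈ S, μ) • p := by
      rw [← hs, Finset.sum_congr rfl hqp, Finset.sum_smul]
    have hin : ⟪x, p⟫ = (∑ μ ∈ S, μ) * ‖p‖ ^ 2 := by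
      have h2 := inner_quadRep p x p
      rw [quadRep_of_mul_eq hp hp, hy, inner_smul_left, real_inner_self_eq_norm_sq] at h2
      exact h2.symm
    rw [hin, hy, smul_smul, mul_comm]
  · rintro ⟨hp, h0, h⟩
    refine ⟨hp, h0, ?_⟩
    rintro ⟨a, b, ha, hb, ha0, hb0, hab⟩
    have hab0 : a * b = 0 := by
      have h2 : (2 : ℝ) • (a * b) = 0 := by
        have h3 := hp
        rw [hab, mul_add, add_mul, add_mul, ha, hb, mul_comm b a] at h3
        have h4 : (2 : ℝ) • (a * b) = (a + a * b + (a * b + b)) - (a + b) := by module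
        rw [h4, h3, sub_self]
      exact (smul_eq_zero.1 h2).resolve_left two_ne_zero
    have hpa : p * a = a := by rw [hab, add_mul, ha, mul_comm, hab0, add_zero]
    have h2 := h a
    rw [quadRep_of_mul_eq hp hpa] at h2
    have h3 := congrArg (fun z => b * z) h2
    simp only [mul_smul_comm] at h3
    have hpb : b * p = b := by rw [hab, mul_add, mul_comm, hab0, hb, zero_add]
    rw [mul_comm b a, hab0, hpb, smul_zero, real_inner_comm, inner_idempotent ha hpa] at h3
    rcases smul_eq_zero.1 h3.symm with h4 | h4
    · exact ha0 (by simpa using h4)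
    · exact hb0 h4

/-- Jordan-orthogonal idempotents are orthogonal for the inner product, hence linearly independent.
-/
theorem card_le_finrank {n : ℕ} {p : Fin n → V} (hq : ∀ i, p i * p i = p i) (h0 : ∀ i, p i ≠ 0)
    (ho : ∀ i j, i ≠ j → p i * p j = 0) : n ≤ Module.finrank ℝ V := by
  have h := linearIndependent_of_ne_zero_of_inner_eq_zero (𝕜 := ℝ) h0
    fun i j hij => inner_eq_zero_of_mul_eq_zero (hq i) (ho i j hij)
  simpa using h.fintype_card_le_finrank

/-- Every element is a linear combination of a Jordan frame. -/
theorem exists_jordanFrame (y : V) : ∃ r ≤ Module.finrank ℝ V, ∃ (p : Fin r → V) (c : Fin r → ℝ),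
    IsJordanFrame p ∧ ∑ i, c i • p i = y := by
  -- If no system were a frame, some member could always be split in two, giving orthogonal systems
  -- longer than the dimension.
  by_contra! hcon
  have key : ∀ k : ℕ, ∃ n ≥ k, ∃ (p : Fin n → V) (c : Fin n → ℝ), (∀ i, p i * p i = p i) ∧
      (∀ i, p i ≠ 0) ∧ (∀ i j, i ≠ j → p i * p j = 0) ∧ ∑ i, p i = 1 ∧ ∑ i, c i • p i = y := by
    intro k
    induction k with
    | zero =>
      obtain ⟨S, q, hq, ho, hne, h1, hs, -⟩ := spectral y
      refine ⟨S.card, Nat.zero_le _, fun i => q (S.equivFin.symm i), fun i => S.equivFin.symm i,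
        fun i => hq _ (Subtype.prop _), fun i => hne _ (Subtype.prop _), fun i j hij =>
        ho _ (Subtype.prop _) _ (Subtype.prop _) fun h => hij ?_, ?_, ?_⟩
      · exact S.equivFin.symm.injective (Subtype.ext h)
      · rw [Equiv.sum_comp S.equivFin.symm (fun s : S => q s), Finset.sum_coe_sort S q, h1]
      · rw [Equiv.sum_comp S.equivFin.symm (fun s : S => (s : ℝ) • q s),
          Finset.sum_coe_sort S fun μ => μ • q μ, hs]
    | succ k ih =>
      obtain ⟨n, hn, p, c, hq, h0, ho, h1, hs⟩ := ih
      have hex : ∃ i, ¬ IsPrimitiveIdempotent (p i) := by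
        by_contra! hall
        exact hcon n (card_le_finrank hq h0 ho) p c ⟨hall, ho, h1⟩ hs
      obtain ⟨i, hi⟩ := hex
      have hi' : ∃ a b : V, a * a = a ∧ b * b = b ∧ a ≠ 0 ∧ b ≠ 0 ∧ p i = a + b := by
        by_contra h
        exact hi ⟨hq i, h0 i, h⟩
      obtain ⟨a, b, ha, hb, ha0, hb0, hab⟩ := hi'
      have hab0 : a * b = 0 := by
        have h2 : (2 : ℝ) • (a * b) = 0 := by
          have h3 := hq i
          rw [hab, mul_add, add_mul, add_mul, ha, hb, mul_comm b a] at h3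
          have h4 : (2 : ℝ) • (a * b) = (a + a * b + (a * b + b)) - (a + b) := by module
          rw [h4, h3, sub_self]
        exact (smul_eq_zero.1 h2).resolve_left two_ne_zero
      have hpa : p i * a = a := by rw [hab, add_mul, ha, mul_comm, hab0, add_zero]
      have hpb : p i * b = b := by rw [hab, add_mul, hb, hab0, zero_add]
      have haj : ∀ j, j ≠ i → a * p j = 0 := fun j hj =>
        peirce_one_mul_zero (hq i) hpa (ho i j hj.symm)
      have hbj : ∀ j, j ≠ i → b * p j = 0 := fun j hj =>
        peirce_one_mul_zero (hq i) hpb (ho i j hj.symm)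
      have hau : ∀ j, a * Function.update p i b j = 0 := by
        intro j
        by_cases hj : j = i
        · subst hj; simpa using hab0
        · simpa [hj] using haj j hj
      -- Both halves of p_i inherit its coefficient; used below for the unit (d = 1) and for y (d =
      -- c).
      have hsum : ∀ d : Fin n → ℝ, d i • a + ∑ j, d j • Function.update p i b j
          = ∑ j, d j • p j := by
        intro d
        rw [← Finset.add_sum_erase _ _ (Finset.mem_univ i),
          ← Finset.add_sum_erase _ (fun j => d j • p j) (Finset.mem_univ i), hab,
          Function.update_self, smul_add, add_assoc]
        congr 2
        refine Finset.sum_congr rfl fun j hj => ?_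
        rw [Function.update_of_ne (Finset.ne_of_mem_erase hj)]
      refine ⟨n + 1, by omega, Fin.cons a (Function.update p i b), Fin.cons (c i) c, ?_, ?_, ?_,
        ?_, ?_⟩
      · refine Fin.cases (by simpa using ha) fun j => ?_
        by_cases hj : j = i
        · subst hj; simpa using hb
        · simpa [hj] using hq j
      · refine Fin.cases (by simpa using ha0) fun j => ?_
        by_cases hj : j = i
        · subst hj; simpa using hb0
        · simpa [hj] using h0 j
      · refine Fin.cases (Fin.cases (fun h => absurd rfl h) fun j _ => ?_)
          fun j => Fin.cases (fun _ => ?_) fun l hjl => ?_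
        · simpa using hau j
        · rw [mul_comm]; simpa using hau j
        · have hjl' : j ≠ l := fun h => hjl (by rw [h])
          simp only [Fin.cons_succ]
          by_cases hj : j = i
          · subst hj
            rw [Function.update_self, Function.update_of_ne hjl'.symm]
            exact hbj l hjl'.symm
          · rw [Function.update_of_ne hj]
            by_cases hl : l = i
            · subst hl
              rw [Function.update_self, mul_comm]
              exact hbj j hj
            · rw [Function.update_of_ne hl]
              exact ho j l hjl'
      · rw [Fin.sum_univ_succ]
        have := hsum fun _ => 1
        simp only [one_smul, h1] at this
        simpa using this
      · rw [Fin.sum_univ_succ]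
        have := hsum c
        rw [hs] at this
        simpa using this
  obtain ⟨n, hn, p, c, hq, h0, ho, -⟩ := key (Module.finrank ℝ V + 1)
  have := card_le_finrank hq h0 ho
  omega

/-- From ‖e‖ = ‖e²‖ ≤ C‖e‖². It prevents members of a frame from vanishing in a limit. -/
theorem exists_norm_idempotent_ge :
    ∃ δ : ℝ, 0 < δ ∧ ∀ e : V, e * e = e → e ≠ 0 → δ ≤ ‖e‖ := by
  obtain ⟨C, hC, h⟩ := exists_norm_mul_le (V := V)
  refine ⟨C⁻¹, by positivity, fun e he h0 => ?_⟩
  have h1 := h e e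
  rw [he] at h1
  have h2 := norm_pos_iff.2 h0
  have h3 : 1 ≤ C * ‖e‖ := by
    by_contra! h4
    have := mul_lt_mul_of_pos_right h4 h2
    linarith
  rw [inv_le_iff_one_le_mul₀ hC]
  linarith

theorem continuous_quadRep (x : V) : Continuous (fun e : V => quadRep e x) := by
  simp only [quadRep_apply]
  fun_prop

/-- A limit of Jordan frames of the same length is a Jordan frame. -/
theorem isJordanFrame_of_tendsto {ι : Type*} {F : Filter ι} [F.NeBot] {pa : ι → Fin r → V}
    (hpa : ∀ᶠ a in F, IsJordanFrame (pa a)) (hP : ∀ i, Tendsto (pa · i) F (𝓝 (p i))) :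
    IsJordanFrame p := by
  obtain ⟨δ, hδ, hδ'⟩ := exists_norm_idempotent_ge (V := V)
  refine ⟨fun i => isPrimitiveIdempotent_iff.2 ⟨?_, ?_, fun x => ?_⟩, fun i j hij => ?_, ?_⟩
  · refine tendsto_nhds_unique_of_eventuallyEq ((hP i).mul (hP i)) (hP i) ?_
    filter_upwards [hpa] with a ha using ha.idem i
  · have h1 : δ ≤ ‖p i‖ := by
      refine ge_of_tendsto (hP i).norm ?_
      filter_upwards [hpa] with a ha using hδ' _ (ha.idem i) (ha.ne_zero i)
    exact norm_pos_iff.1 (hδ.trans_le h1)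
  · refine tendsto_nhds_unique_of_eventuallyEq
      (((hP i).norm.pow 2).smul (((continuous_quadRep x).tendsto _).comp (hP i)))
      ((tendsto_const_nhds.inner (hP i)).smul (hP i)) ?_
    filter_upwards [hpa] with a ha using (isPrimitiveIdempotent_iff.1 (ha.primitive i)).2.2 x
  · refine tendsto_nhds_unique_of_eventuallyEq ((hP i).mul (hP j)) tendsto_const_nhds ?_
    filter_upwards [hpa] with a ha using ha.orthogonal i j hij
  · refine tendsto_nhds_unique_of_eventuallyEq (tendsto_finsetSum _ fun i _ => hP i)
      tendsto_const_nhds ?_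
    filter_upwards [hpa] with a ha using ha.sum_eq_one

end Frames

/-! ### Positivity along an ultrafilter and the limit of internal points -/

section Limits

local notation "⟪" x "," y "⟫" => inner ℝ x y

variable {V : Type*} [NonAssocCommRing V] [Module ℝ V] [SMulCommClass ℝ V V] [IsScalarTower ℝ V V]
  [EuclideanForm V] [IsCommJordan V] [FiniteDimensional ℝ V]
  {ι : Type*} {r : ℕ} {pa : ι → Fin r → V} {p : Fin r → V} {β : ι → Fin r → ℝ}
  {J : Finset (Fin r)} {b : Fin r → ℝ}

theorem tendsto_frameSum {F : Filter ι} (hP : ∀ i, Tendsto (pa · i) F (𝓝 (p i))) :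
    Tendsto (fun a => frameSum (pa a) J) F (𝓝 (frameSum p J)) :=
  tendsto_finsetSum _ fun i _ => hP i

/-- If the coefficients `β i` with `i ∈ J` converge to `b i`, while the others tend to infinity, then
`s u - x + ∑ β_i p_i` is eventually positive as soon as its compression to `V(p_J)` is bounded
below by a positive multiple of `p_J` in the limit. -/
theorem eventually_mem_cone (F : Ultrafilter ι) (hpa : ∀ᶠ a in F, IsJordanFrame (pa a))
    (hP : ∀ i, Tendsto (pa · i) F (𝓝 (p i))) (hβ : ∀ᶠ a in F, ∀ i, 0 ≤ β a i)
    (hJ : ∀ j ∈ J, Tendsto (β · j) F (𝓝 (b j))) (hJ' : ∀ i ∉ J, Tendsto (β · i) F atTop)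
    (x : V) {s t : ℝ} (hst : s < t)
    (h : s • frameSum p J - (quadRep (frameSum p J) x - ∑ j ∈ J, b j • p j) ∈ cone V) :
    ∀ᶠ a in F, t • (1 : V) - x + ∑ i, β a i • pa a i ∈ cone V := by
  have hp : IsJordanFrame p := isJordanFrame_of_tendsto hpa hP
  by_contra hcon
  rw [← Ultrafilter.eventually_not] at hcon
  have hex : ∀ a, ∃ v : V, t • (1 : V) - x + ∑ i, β a i • pa a i ∉ cone V →
      ‖v‖ = 1 ∧ ⟪t • (1 : V) - x + ∑ i, β a i • pa a i, v * v⟫ < 0 := by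
    intro a
    by_cases hm : t • (1 : V) - x + ∑ i, β a i • pa a i ∈ cone V
    · exact ⟨0, fun h => absurd hm h⟩
    · have hm' := hm
      rw [mem_cone_iff_unit] at hm'
      push Not at hm'
      obtain ⟨v, hv⟩ := hm'
      exact ⟨v, fun _ => hv⟩
  choose v hv using hex
  -- Unit vectors witnessing non-positivity converge along the ultrafilter; the limit w will
  -- contradict `h`.
  have hsph : Metric.sphere (0 : V) 1 ∈ F.map v := by
    rw [Ultrafilter.mem_map]
    filter_upwards [hcon] with a ha
    simpa using (hv a ha).1
  obtain ⟨w, hw1, hw⟩ := (isCompact_sphere (0 : V) 1).ultrafilter_le_nhds' _ hsph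
  replace hw : Tendsto v F (𝓝 w) := hw
  replace hw1 : ‖w‖ = 1 := by simpa using hw1
  set c : ι → ℝ := fun a => ⟪x - t • (1 : V), v a * v a⟫ with hc
  have hclim : Tendsto c F (𝓝 ⟪x - t • (1 : V), w * w⟫) := tendsto_const_nhds.inner (hw.mul hw)
  have hineq : ∀ᶠ a in F, ∑ i, β a i * ⟪pa a i, v a * v a⟫ ≤ c a := by
    filter_upwards [hcon] with a ha
    have h1 := (hv a ha).2
    rw [inner_add_left, sum_inner] at h1
    simp only [inner_smul_left, RCLike.conj_to_real] at h1
    have h2 : c a = -⟪t • (1 : V) - x, v a * v a⟫ := by rw [← inner_neg_left, neg_sub]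
    linarith
  have hnn : ∀ᶠ a in F, ∀ i, 0 ≤ β a i * ⟪pa a i, v a * v a⟫ := by
    filter_upwards [hpa, hβ] with a ha hb i
    exact mul_nonneg (hb i) (inner_idempotent_sq_nonneg (ha.idem i) _)
  have hlim : ∀ i, Tendsto (fun a => ⟪pa a i, v a * v a⟫) F (𝓝 ⟪p i, w * w⟫) := fun i =>
    (hP i).inner (hw.mul hw)
  -- A term `β a i * ⟪pa a i, v a * v a⟫` is at most `c a`, which converges; as the coefficient
  -- tends to infinity, ⟪p_i, w²⟫ = 0.
  have hzero : ∀ i ∉ J, p i * w = 0 := by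
    intro i hi
    refine mul_eq_zero_of_inner_sq (hp.idem i) ?_
    refine le_antisymm ?_ (inner_idempotent_sq_nonneg (hp.idem i) w)
    refine le_of_tendsto_of_tendsto (hlim i) (hclim.div_atTop (hJ' i hi)) ?_
    filter_upwards [hineq, hnn, (hJ' i hi).eventually_gt_atTop 0] with a h1 h2 h3
    rw [le_div_iff₀ h3, mul_comm]
    exact (Finset.single_le_sum (fun j _ => h2 j) (Finset.mem_univ i)).trans h1
  have hwJ : frameSum p J * w = w := hp.frameSum_mul_of_forall hzero
  have hwwJ : frameSum p J * (w * w) = w * w := peirce_one_mul (hp.frameSum_idem J) hwJ hwJ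
  have hle : ∑ j ∈ J, b j * ⟪p j, w * w⟫ ≤ ⟪x - t • (1 : V), w * w⟫ := by
    refine le_of_tendsto_of_tendsto (tendsto_finsetSum J fun j hj => (hJ j hj).mul (hlim j))
      hclim ?_
    filter_upwards [hineq, hnn] with a h1 h2
    exact (Finset.sum_le_sum_of_subset_of_nonneg (Finset.subset_univ J)
      fun i _ _ => h2 i).trans h1
  have h1 := mem_cone_iff.1 h w
  have hone : ⟪frameSum p J, w * w⟫ = 1 := by
    rw [← inner_mul_right, hwJ, real_inner_self_eq_norm_sq, hw1, one_pow]
  rw [inner_sub_left, inner_sub_left, inner_quadRep, quadRep_of_mul_eq (hp.frameSum_idem J) hwwJ,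
    inner_smul_left, hone, sum_inner] at h1
  rw [inner_sub_left, inner_smul_left, inner_one_mul_self, hw1] at hle
  simp only [inner_smul_left, RCLike.conj_to_real] at h1 hle
  linarith

/-- An idempotent q of V(p_J) witnessing negativity is moved into the corner of the approximating
frame by `quadRep`. There the p_i with i ∉ J pair to zero with its square, so their uncontrolled
coefficients do not matter. -/
theorem eventually_notMem_cone {F : Filter ι} [F.NeBot] (hpa : ∀ᶠ a in F, IsJordanFrame (pa a))
    (hP : ∀ i, Tendsto (pa · i) F (𝓝 (p i)))
    (hJ : ∀ j ∈ J, Tendsto (β · j) F (𝓝 (b j))) (x : V) {t : ℝ}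
    (h : t • frameSum p J - (quadRep (frameSum p J) x - ∑ j ∈ J, b j • p j) ∉ cone V) :
    ∀ᶠ a in F, t • (1 : V) - x + ∑ i, β a i • pa a i ∉ cone V := by
  have hp : IsJordanFrame p := isJordanFrame_of_tendsto hpa hP
  have hz : frameSum p J * (t • frameSum p J - (quadRep (frameSum p J) x - ∑ j ∈ J, b j • p j))
      = t • frameSum p J - (quadRep (frameSum p J) x - ∑ j ∈ J, b j • p j) := by
    rw [mul_sub, mul_sub, mul_smul_comm, hp.frameSum_idem, mul_quadRep (hp.frameSum_idem J),
      hp.frameSum_mul_sum]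
  rcases sq_or_exists_idempotent (hp.frameSum_idem J) hz with ⟨y, -, hy⟩ | ⟨q, hq, hpq, hlt⟩
  · exact absurd ⟨y, hy⟩ h
  have hone : ⟪frameSum p J, q⟫ = ⟪(1 : V), q⟫ := by
    conv_rhs => rw [← hpq, ← inner_mul_right, one_mul]
  rw [inner_sub_left, inner_sub_left, inner_quadRep, quadRep_of_mul_eq (hp.frameSum_idem J) hpq,
    inner_smul_left, hone, sum_inner] at hlt
  set v : ι → V := fun a => quadRep (frameSum (pa a) J) q with hv
  have hvlim : Tendsto v F (𝓝 q) := by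
    have := ((continuous_quadRep q).tendsto _).comp (tendsto_frameSum (J := J) hP)
    rwa [quadRep_of_mul_eq (hp.frameSum_idem J) hpq] at this
  have hvv : Tendsto (fun a => v a * v a) F (𝓝 q) := by
    have := hvlim.mul hvlim
    rwa [hq] at this
  have hlim : Tendsto (fun a => ⟪t • (1 : V) - x, v a * v a⟫ + ∑ j ∈ J, β a j *
      ⟪pa a j, v a * v a⟫) F (𝓝 (⟪t • (1 : V) - x, q⟫ + ∑ j ∈ J, b j * ⟪p j, q⟫)) :=
    (tendsto_const_nhds.inner hvv).add
      (tendsto_finsetSum J fun j hj => (hJ j hj).mul ((hP j).inner hvv))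
  have hneg : ⟪t • (1 : V) - x, q⟫ + ∑ j ∈ J, b j * ⟪p j, q⟫ < 0 := by
    rw [inner_sub_left, inner_smul_left]
    simp only [inner_smul_left, RCLike.conj_to_real] at hlt ⊢
    linarith
  filter_upwards [hpa, hlim.eventually_lt_const hneg] with a ha h1 hmem
  have h2 := mem_cone_iff.1 hmem (v a)
  have hva := mul_quadRep (ha.frameSum_idem J) q
  have hvva := peirce_one_mul (ha.frameSum_idem J) hva hva
  rw [inner_add_left, sum_inner, ← Finset.sum_subset (Finset.subset_univ J)] at h2
  · simp only [inner_smul_left, RCLike.conj_to_real] at h2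
    exact absurd h1 (not_lt.2 h2)
  · intro i _ hi
    rw [inner_smul_left, inner_eq_zero_of_mul_eq_zero (ha.idem i) (ha.mul_eq_zero hvva hi),
      mul_zero]

theorem maxEigenvalue_frame_le_iff (hp : IsJordanFrame p) (hJ : J.Nonempty) (x : V) {t : ℝ} :
    posTerm p J b x ≤ t ↔
      t • frameSum p J - (quadRep (frameSum p J) x - ∑ j ∈ J, b j • p j) ∈ cone V :=
  maxEigenvalue_le_iff (hp.frameSum_idem J) (hp.frameSum_ne_zero hJ)
    (by rw [mul_sub, mul_quadRep (hp.frameSum_idem J), hp.frameSum_mul_sum])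

theorem negTerm_eq_posTerm (I : Finset (Fin r)) (x : V) : negTerm p I b x = posTerm p I b (-x) := by
  rw [negTerm, posTerm, map_neg]

/-- Over an empty index set the cone condition reads 0 ∈ V₊, so the three cases of the definition
have one description. -/
theorem horoForm_le_iff (hp : IsJordanFrame p) {I : Finset (Fin r)} (hIJ : (I ∪ J).Nonempty)
    (x : V) {t : ℝ} : horoForm p I J b x ≤ t ↔
      t • frameSum p I - (quadRep (frameSum p I) (-x) - ∑ j ∈ I, b j • p j) ∈ cone V ∧
      t • frameSum p J - (quadRep (frameSum p J) x - ∑ j ∈ J, b j • p j) ∈ cone V := by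
  have hempty : ∀ y, t • frameSum p ∅ - (quadRep (frameSum p ∅) y - ∑ j ∈ ∅, b j • p j) ∈ cone V :=
    fun y => ⟨0, by simp [frameSum, quadRep_apply]⟩
  rw [horoForm]
  split_ifs with hI hJ
  · subst hI
    rw [maxEigenvalue_frame_le_iff hp (by simpa using hIJ)]
    exact ⟨fun h => ⟨hempty _, h⟩, fun h => h.2⟩
  · subst hJ
    rw [negTerm_eq_posTerm, maxEigenvalue_frame_le_iff hp (Finset.nonempty_iff_ne_empty.2 hI)]
    exact ⟨fun h => ⟨h, hempty _⟩, fun h => h.1⟩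
  · rw [max_le_iff, negTerm_eq_posTerm, maxEigenvalue_frame_le_iff hp
      (Finset.nonempty_iff_ne_empty.2 hI), maxEigenvalue_frame_le_iff hp
      (Finset.nonempty_iff_ne_empty.2 hJ)]

theorem IsJordanFrame.smul_one (hp : IsJordanFrame p) (t : ℝ) : t • (1 : V) = ∑ i, t • p i := by
  rw [← hp.sum_eq_one, Finset.smul_sum]

/-- The limit of the internal points of `∑ c_i p_i`, when the numbers `ρ ± c_i` stay nonnegative
and either converge or tend to infinity. -/
theorem tendsto_horoForm (F : Ultrafilter ι) (hpa : ∀ᶠ a in F, IsJordanFrame (pa a))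
    (hP : ∀ i, Tendsto (pa · i) F (𝓝 (p i))) {c : ι → Fin r → ℝ} {ρ : ι → ℝ}
    (hρ : Tendsto ρ F atTop) (hc : ∀ᶠ a in F, ∀ i, |c a i| ≤ ρ a) {I : Finset (Fin r)}
    (hIJ : (I ∪ J).Nonempty)
    (hI : ∀ j ∈ I, Tendsto (fun a => ρ a - c a j) F (𝓝 (b j)))
    (hI' : ∀ j ∉ I, Tendsto (fun a => ρ a - c a j) F atTop)
    (hJ : ∀ j ∈ J, Tendsto (fun a => ρ a + c a j) F (𝓝 (b j)))
    (hJ' : ∀ j ∉ J, Tendsto (fun a => ρ a + c a j) F atTop) (x : V) :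
    Tendsto (fun a => spectralDist x (∑ i, c a i • pa a i) - ρ a) F (𝓝 (horoForm p I J b x)) := by
  have hp : IsJordanFrame p := isJordanFrame_of_tendsto hpa hP
  have hc1 : ∀ᶠ a in F, ∀ i, 0 ≤ ρ a - c a i := by
    filter_upwards [hc] with a ha i using by linarith [le_abs_self (c a i), ha i]
  have hc2 : ∀ᶠ a in F, ∀ i, 0 ≤ ρ a + c a i := by
    filter_upwards [hc] with a ha i using by linarith [neg_abs_le (c a i), ha i]
  have hiff : ∀ t, ∀ᶠ a in F, (spectralDist x (∑ i, c a i • pa a i) - ρ a ≤ t ↔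
      t • (1 : V) - -x + ∑ i, (ρ a - c a i) • pa a i ∈ cone V ∧
      t • (1 : V) - x + ∑ i, (ρ a + c a i) • pa a i ∈ cone V) := by
    intro t
    -- Once ρ ≥ -t, the requirement 0 ≤ t + ρ in the norm criterion is automatic.
    filter_upwards [hpa, hρ.eventually_ge_atTop (-t)] with a ha h1
    have e1 : (t + ρ a) • (1 : V) - (x - ∑ i, c a i • pa a i)
        = t • (1 : V) - x + ∑ i, (ρ a + c a i) • pa a i := by
      simp only [add_smul, Finset.sum_add_distrib, ha.smul_one (ρ a)]
      abel
    have e2 : (t + ρ a) • (1 : V) + (x - ∑ i, c a i • pa a i)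
        = t • (1 : V) - -x + ∑ i, (ρ a - c a i) • pa a i := by
      simp only [add_smul, sub_smul, Finset.sum_sub_distrib, ha.smul_one (ρ a)]
      abel
    rw [spectralDist, sub_le_iff_le_add, orderUnitNorm_le_iff, e1, e2]
    constructor
    · exact fun h => ⟨h.2.2, h.2.1⟩
    · exact fun h => ⟨by linarith, h.2, h.1⟩
  refine tendsto_order.2 ⟨fun t ht => ?_, fun t ht => ?_⟩
  · have hnot := (horoForm_le_iff hp hIJ x).not.1 (not_le.2 ht)
    rw [not_and_or] at hnot
    rcases hnot with hnot | hnot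
    · filter_upwards [hiff t, eventually_notMem_cone hpa hP hI (-x) hnot] with a h1 h2
      exact not_le.1 fun h => h2 (h1.1 h).1
    · filter_upwards [hiff t, eventually_notMem_cone hpa hP hJ x hnot] with a h1 h2
      exact not_le.1 fun h => h2 (h1.1 h).2
  -- Two intermediate values: s < s' is the slack needed by `eventually_mem_cone`, and s' < t makes
  -- the final inequality strict.
  · obtain ⟨s', hs', hs't⟩ := exists_between ht
    obtain ⟨s, hs, hss'⟩ := exists_between hs'
    obtain ⟨h1, h2⟩ := (horoForm_le_iff hp hIJ x).1 hs.le
    filter_upwards [hiff s', eventually_mem_cone F hpa hP hc1 hI hI' (-x) hss' h1,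
      eventually_mem_cone F hpa hP hc2 hJ hJ' x hss' h2] with a h3 h4 h5
    exact (h3.2 ⟨h4, h5⟩).trans_lt hs't

end Limits

/-! ### Realising sequences, and the classification of horofunctions -/

section Norm

local notation "⟪" x "," y "⟫" => inner ℝ x y

variable {V : Type*} [NonAssocCommRing V] [Module ℝ V] [SMulCommClass ℝ V V] [IsScalarTower ℝ V V]
  [EuclideanForm V] [IsCommJordan V] [FiniteDimensional ℝ V] {r : ℕ} {p : Fin r → V}

theorem IsJordanFrame.sum_mem_cone_iff (hp : IsJordanFrame p) (d : Fin r → ℝ) :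
    ∑ i, d i • p i ∈ cone V ↔ ∀ i, 0 ≤ d i := by
  constructor
  · intro h i
    have h1 := mem_cone_iff.1 h (p i)
    rw [hp.idem, sum_inner, Finset.sum_eq_single i, inner_smul_left,
      real_inner_self_eq_norm_sq] at h1
    · have := norm_pos_iff.2 (hp.ne_zero i)
      exact nonneg_of_mul_nonneg_left h1 (by positivity)
    · intro j _ hj
      rw [inner_smul_left, inner_eq_zero_of_mul_eq_zero (hp.idem j) (hp.orthogonal j i hj),
        mul_zero]
    · exact fun h => absurd (Finset.mem_univ i) h
  · exact fun h => sum_mem_cone fun i _ => smul_mem_cone (h i) (idempotent_mem_cone (hp.idem i))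

/-- The clause `0 ≤ t` matters only for the empty frame of the zero algebra. -/
theorem IsJordanFrame.orderUnitNorm_le_iff (hp : IsJordanFrame p) (c : Fin r → ℝ) {t : ℝ} :
    orderUnitNorm (∑ i, c i • p i) ≤ t ↔ 0 ≤ t ∧ ∀ i, |c i| ≤ t := by
  rw [EJA.orderUnitNorm_le_iff, hp.smul_one, ← Finset.sum_sub_distrib, ← Finset.sum_add_distrib]
  simp only [← sub_smul, ← add_smul]
  rw [hp.sum_mem_cone_iff, hp.sum_mem_cone_iff]
  simp only [abs_le]
  refine and_congr_right fun _ => ⟨fun h i => ⟨?_, ?_⟩, fun h => ⟨fun i => ?_, fun i => ?_⟩⟩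
  · linarith [h.2 i]
  · linarith [h.1 i]
  · linarith [(h i).2]
  · linarith [(h i).1]

theorem orderUnitNorm_nonneg (x : V) : 0 ≤ orderUnitNorm x := (orderUnitNorm_le_iff.1 le_rfl).1

theorem orderUnitNorm_neg (x : V) : orderUnitNorm (-x) = orderUnitNorm x := by
  refine eq_of_forall_ge_iff fun t => ?_
  rw [orderUnitNorm_le_iff, orderUnitNorm_le_iff, sub_neg_eq_add, ← sub_eq_add_neg]
  tauto

theorem spectralDist_zero_left (y : V) : spectralDist 0 y = orderUnitNorm y := by
  rw [spectralDist, zero_sub, orderUnitNorm_neg]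

theorem continuous_orderUnitNorm : Continuous (orderUnitNorm : V → ℝ) := by
  obtain ⟨C, hC0, hC⟩ := exists_smul_one_sub_mem_cone (V := V)
  refine (LipschitzWith.of_le_add_mul C.toNNReal fun x y => ?_).continuous
  obtain ⟨h0, h1, h2⟩ := orderUnitNorm_le_iff.1 (le_refl (orderUnitNorm y))
  have h3 := hC (x - y) _ le_rfl
  have h4 := hC (y - x) _ le_rfl
  rw [norm_sub_rev] at h4
  rw [dist_eq_norm, Real.coe_toNNReal C hC0.le]
  refine orderUnitNorm_le_iff.2 ⟨by positivity, ?_, ?_⟩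
  · convert add_mem_cone h1 h3 using 1
    module
  · convert add_mem_cone h2 h4 using 1
    module

/-- The sequence `∑_{i ∈ I} (n - α_i) p_i - ∑_{j ∈ J} (n - α_j) p_j` is almost geodesic and
converges to the horofunction given by `I`, `J` and `α`. -/
theorem exists_seq_tendsto_horoForm (hp : IsJordanFrame p) {I J : Finset (Fin r)} {α : Fin r → ℝ}
    (hdis : Disjoint I J) (hne : (I ∪ J).Nonempty)
    (hα : IsLeast (α '' (↑(I ∪ J) : Set (Fin r))) 0) :
    ∃ (y : ℕ → V) (N : ℕ), (∀ n ≥ N, orderUnitNorm (y n) = n) ∧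
      (∀ m n : ℕ, m ≤ n → orderUnitNorm (y n - y m) ≤ n - m) ∧
      ∀ x, Tendsto (fun n => spectralDist x (y n) - n) atTop (𝓝 (horoForm p I J α x)) := by
  classical
  set c : ℕ → Fin r → ℝ := fun n i =>
    if i ∈ I then n - α i else if i ∈ J then -(n - α i) else 0 with hc
  -- Past N every α_i is at most n, so that |n - α_i| ≤ n for i ∈ I ∪ J; an index with α_i = 0 makes
  -- the norm exactly n.
  obtain ⟨N, hN⟩ := exists_nat_ge (∑ i, |α i|)
  have hαN : ∀ i, α i ≤ N := fun i => (le_abs_self _).trans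
    ((Finset.single_le_sum (fun j _ => abs_nonneg (α j)) (Finset.mem_univ i)).trans hN)
  have hα0 : ∀ i ∈ I ∪ J, 0 ≤ α i := fun i hi => hα.2 ⟨i, hi, rfl⟩
  have hcle : ∀ n ≥ N, ∀ i, |c n i| ≤ n := by
    intro n hn i
    have hn' : (N : ℝ) ≤ n := by exact_mod_cast hn
    have h1 := hαN i
    simp only [hc]
    split_ifs with hi hj
    · have := hα0 i (Finset.mem_union_left _ hi)
      rw [abs_le]; constructor <;> linarith
    · have := hα0 i (Finset.mem_union_right _ hj)
      rw [abs_neg, abs_le]; constructor <;> linarith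
    · simp
  refine ⟨fun n => ∑ i, c n i • p i, N, fun n hn => ?_, fun m n hmn => ?_, fun x => ?_⟩
  · refine le_antisymm ((hp.orderUnitNorm_le_iff _).2 ⟨by positivity, hcle n hn⟩) ?_
    obtain ⟨i, hi, h0⟩ := hα.1
    have h1 := ((hp.orderUnitNorm_le_iff (c n)).1 le_rfl).2 i
    refine le_trans (le_of_eq ?_) h1
    rcases Finset.mem_union.1 (Finset.mem_coe.1 hi) with h | h
    · simp [hc, h, h0]
    · simp [hc, h, h0, Finset.disjoint_right.1 hdis h]
  · have hmn' : (m : ℝ) ≤ n := by exact_mod_cast hmn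
    rw [← Finset.sum_sub_distrib]
    simp only [← sub_smul]
    refine (hp.orderUnitNorm_le_iff _).2 ⟨by linarith, fun i => ?_⟩
    simp only [hc]
    split_ifs
    · rw [abs_le]; constructor <;> linarith
    · rw [abs_le]; constructor <;> linarith
    · rw [abs_le]; constructor <;> linarith
  · rw [tendsto_iff_ultrafilter]
    intro F hF
    have hnat : Tendsto (fun n : ℕ => (n : ℝ)) F atTop := tendsto_natCast_atTop_atTop.mono_left hF
    have hshift : ∀ a : ℝ, Tendsto (fun n : ℕ => (n : ℝ) + (n - a)) F atTop := fun a =>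
      hnat.atTop_add_atTop (tendsto_atTop_add_const_right _ (-a) hnat)
    refine tendsto_horoForm F (pa := fun _ => p) (Eventually.of_forall fun _ => hp)
      (fun i => tendsto_const_nhds) hnat (hF (eventually_atTop.2 ⟨N, hcle⟩)) hne ?_ ?_ ?_ ?_ x
    · intro i hi
      simp [hc, hi]
    · intro i hi
      by_cases hj : i ∈ J
      · refine (hshift (α i)).congr fun n => ?_
        simp [hc, hi, hj]
        ring
      · simpa [hc, hi, hj] using hnat
    · intro i hi
      simp [hc, hi, Finset.disjoint_right.1 hdis hi]
    · intro i hj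
      by_cases hi : i ∈ I
      · simpa [hc, hi] using hshift (α i)
      · simpa [hc, hi, hj] using hnat

/-- At s(p_I - p_J) both compressed arguments equal -s times the unit of their corner, and
subtracting α ≥ 0 only lowers them. -/
theorem horoForm_unbounded (hp : IsJordanFrame p) {I J : Finset (Fin r)} {α : Fin r → ℝ}
    (hdis : Disjoint I J) (hne : (I ∪ J).Nonempty)
    (hα : ∀ i ∈ I ∪ J, 0 ≤ α i) (s : ℝ) : ∃ x, horoForm p I J α x ≤ -s := by
  have key : ∀ K L : Finset (Fin r), Disjoint K L → (∀ i ∈ K, 0 ≤ α i) →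
      (-s) • frameSum p K - (quadRep (frameSum p K) (s • frameSum p L - s • frameSum p K)
        - ∑ i ∈ K, α i • p i) ∈ cone V := by
    intro K L hKL h0
    have e : quadRep (frameSum p K) (s • frameSum p L - s • frameSum p K)
        = (-s) • frameSum p K := by
      rw [map_sub, map_smul, map_smul, quadRep_apply, hp.frameSum_idem K,
        hp.frameSum_mul_frameSum hKL, quadRep_of_mul_eq (hp.frameSum_idem K) (hp.frameSum_idem K)]
      simp
    rw [e, sub_sub_cancel]
    exact sum_mem_cone fun i hi => smul_mem_cone (h0 i hi) (idempotent_mem_cone (hp.idem i))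
  refine ⟨s • frameSum p I - s • frameSum p J, (horoForm_le_iff hp hne _).2 ⟨?_, ?_⟩⟩
  · rw [neg_sub]
    exact key I J hdis fun i hi => hα i (Finset.mem_union_left _ hi)
  · exact key J I hdis.symm fun i hi => hα i (Finset.mem_union_right _ hi)

theorem horoForm_mem_boundary (hp : IsJordanFrame p) {I J : Finset (Fin r)} {α : Fin r → ℝ}
    (hdis : Disjoint I J) (hne : (I ∪ J).Nonempty)
    (hα : IsLeast (α '' (↑(I ∪ J) : Set (Fin r))) 0) :
    horoForm p I J α ∈ Horo.boundary (spectralDist (V := V)) 0 := by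
  obtain ⟨y, N, hy, -, hlim⟩ := exists_seq_tendsto_horoForm hp hdis hne hα
  constructor
  · refine mem_closure_of_tendsto (f := fun n => Horo.internalPoint spectralDist 0 (y n))
      (b := atTop) (tendsto_pi_nhds.2 fun x => ?_) (Eventually.of_forall fun n => ⟨_, rfl⟩)
    refine (hlim x).congr' ?_
    filter_upwards [eventually_ge_atTop N] with n hn
    rw [Horo.internalPoint, spectralDist_zero_left, hy n hn]
  · rintro ⟨w, hw⟩
    -- An internal point at w is bounded below by -‖w‖_u.
    obtain ⟨x, hx⟩ := horoForm_unbounded hp hdis hne (fun i hi => hα.2 ⟨i, hi, rfl⟩)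
      (orderUnitNorm w + 1)
    rw [← hw, Horo.internalPoint, spectralDist_zero_left] at hx
    have := orderUnitNorm_nonneg (x - w)
    rw [spectralDist] at hx
    linarith

theorem isBusemannPoint_horoForm (hp : IsJordanFrame p) {I J : Finset (Fin r)} {α : Fin r → ℝ}
    (hdis : Disjoint I J) (hne : (I ∪ J).Nonempty)
    (hα : IsLeast (α '' (↑(I ∪ J) : Set (Fin r))) 0) :
    Horo.IsBusemannPoint (spectralDist (V := V)) 0 (horoForm p I J α) := by
  refine ⟨horoForm_mem_boundary hp hdis hne hα, ?_⟩
  obtain ⟨y, N, hy, hyd, hlim⟩ := exists_seq_tendsto_horoForm hp hdis hne hα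
  -- With reference point 0, the almost-geodesic defect is at most (n - m) + m - n = 0. The lift
  -- places ℕ in the universe of V.
  refine ⟨ULift ℕ, inferInstance, inferInstance, inferInstance, fun n => y n.down,
    ⟨0, fun ε hε => ⟨⟨N⟩, fun a a' h1 h2 => ?_⟩⟩, fun z => ?_⟩
  · have h1' : N ≤ a'.down := h1
    have h2' : a'.down ≤ a.down := h2
    simp only [spectralDist, sub_zero]
    rw [hy _ h1', hy _ (h1'.trans h2')]
    linarith [hyd _ _ h2']
  · have hdown : Tendsto (ULift.down : ULift ℕ → ℕ) atTop atTop :=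
      tendsto_atTop.2 fun n => (eventually_ge_atTop (ULift.up n)).mono fun a ha => ha
    refine ((hlim z).comp hdown).congr' ?_
    filter_upwards [eventually_ge_atTop (ULift.up N)] with n hn
    have hn' : N ≤ n.down := hn
    simp [spectralDist_zero_left, hy _ hn']

theorem ultrafilter_tendsto_atTop_or_nhds {ι : Type*} (F : Ultrafilter ι) {f : ι → ℝ}
    (hf : ∀ᶠ a in F, 0 ≤ f a) : Tendsto f F atTop ∨ ∃ b, Tendsto f F (𝓝 b) := by
  refine or_iff_not_imp_left.2 fun h => ?_
  rw [tendsto_atTop] at h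
  push Not at h
  obtain ⟨M, hM⟩ := h
  have : Set.Icc 0 M ∈ F.map f := by
    rw [Ultrafilter.mem_map]
    filter_upwards [hf, hM] with a h1 h2
    exact ⟨h1, h2.le⟩
  obtain ⟨b, -, hb⟩ := isCompact_Icc.ultrafilter_le_nhds' _ this
  exact ⟨b, hb⟩

/-- The length of the frame depends on y but takes finitely many values, so the ultrafilter selects
one; bounded idempotents then converge. -/
theorem exists_ultrafilter_jordanFrame (F : Ultrafilter V) : ∃ (r : ℕ) (pa : V → Fin r → V)
    (c : V → Fin r → ℝ) (p : Fin r → V), (∀ᶠ y in F, IsJordanFrame (pa y)) ∧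
    (∀ᶠ y in F, ∑ i, c y i • pa y i = y) ∧ ∀ i, Tendsto (pa · i) F (𝓝 (p i)) := by
  have h1 : ∀ᶠ y in F, ∃ r ∈ Set.Iic (Module.finrank ℝ V), ∃ (p : Fin r → V) (c : Fin r → ℝ),
    IsJordanFrame p ∧ ∑ i, c i • p i = y := Eventually.of_forall exists_jordanFrame
  obtain ⟨r, -, h2⟩ := (Ultrafilter.eventually_exists_mem_iff (Set.finite_Iic _)).1 h1
  obtain ⟨pa, h3⟩ := h2.choice
  obtain ⟨c, h4⟩ := h3.choice
  have hlim : ∀ i, ∃ q, Tendsto (pa · i) F (𝓝 q) := by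
    intro i
    have : Metric.closedBall (0 : V) ‖(1 : V)‖ ∈ F.map (pa · i) := by
      rw [Ultrafilter.mem_map]
      filter_upwards [h4] with y hy
      simpa using norm_idempotent_le (hy.1.idem i)
    obtain ⟨q, -, hq⟩ := (isCompact_closedBall (0 : V) ‖(1 : V)‖).ultrafilter_le_nhds' _ this
    exact ⟨q, hq⟩
  choose p hp using hlim
  exact ⟨r, pa, c, p, h4.mono fun _ h => h.1, h4.mono fun _ h => h.2, hp⟩

theorem exists_horoForm_of_mem_boundary {h : V → ℝ}
    (hh : h ∈ Horo.boundary (spectralDist (V := V)) 0) :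
    ∃ (r : ℕ) (p : Fin r → V) (I J : Finset (Fin r)) (α : Fin r → ℝ),
      IsJordanFrame p ∧ Disjoint I J ∧ (I ∪ J).Nonempty ∧
      IsLeast (α '' (↑(I ∪ J) : Set (Fin r))) 0 ∧ ∀ x : V, h x = horoForm p I J α x := by
  classical
  have hne : (comap (Horo.internalPoint (spectralDist (V := V)) 0) (𝓝 h)).NeBot := by
    refine comap_neBot fun t ht => ?_
    obtain ⟨_, h1, y, rfl⟩ := mem_closure_iff_nhds.1 hh.1 t ht
    exact ⟨y, h1⟩
  set F := Ultrafilter.of (comap (Horo.internalPoint (spectralDist (V := V)) 0) (𝓝 h)) with hF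
  have hlim : ∀ x, Tendsto (fun y => spectralDist x y - orderUnitNorm y) F (𝓝 (h x)) := by
    intro x
    have h1 : Tendsto (Horo.internalPoint (spectralDist (V := V)) 0) F (𝓝 h) :=
      tendsto_comap.mono_left (Ultrafilter.of_le _)
    have h2 := tendsto_pi_nhds.1 h1 x
    simpa only [Horo.internalPoint, spectralDist_zero_left] using h2
  obtain ⟨r, pa, c, p, hpa, hsum, hP⟩ := exists_ultrafilter_jordanFrame F
  have hp : IsJordanFrame p := isJordanFrame_of_tendsto hpa hP
  have hc : ∀ᶠ y in F, ∀ i, |c y i| ≤ orderUnitNorm y := by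
    filter_upwards [hpa, hsum] with y h1 h2
    exact ((h1.orderUnitNorm_le_iff (c y)).1 (by rw [h2])).2
  have hc1 : ∀ᶠ y in F, ∀ i, 0 ≤ orderUnitNorm y - c y i := by
    filter_upwards [hc] with a ha i using by linarith [le_abs_self (c a i), ha i]
  have hc2 : ∀ᶠ y in F, ∀ i, 0 ≤ orderUnitNorm y + c y i := by
    filter_upwards [hc] with a ha i using by linarith [neg_abs_le (c a i), ha i]
  have hd1 := fun i => ultrafilter_tendsto_atTop_or_nhds F (hc1.mono fun y h => h i)
  have hd2 := fun i => ultrafilter_tendsto_atTop_or_nhds F (hc2.mono fun y h => h i)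
  rcases ultrafilter_tendsto_atTop_or_nhds F (f := orderUnitNorm)
    (Eventually.of_forall orderUnitNorm_nonneg) with hρ | ⟨b, hb⟩
  swap
  -- If the norms converge, so do all c_i (otherwise 2ρ ≥ ρ + c_i → ∞), hence y converges and h is
  -- internal.
  · exfalso
    have hclim : ∀ i, ∃ γ, Tendsto (c · i) F (𝓝 γ) := by
      intro i
      rcases hd2 i with h1 | ⟨γ, h1⟩
      · refine absurd (hb.add hb) (not_tendsto_nhds_of_tendsto_atTop
          (tendsto_atTop_mono' _ ?_ h1) _)
        filter_upwards [hc1] with y hy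
        linarith [hy i]
      · exact ⟨γ - b, by simpa using h1.sub hb⟩
    choose γ hγ using hclim
    have hy : Tendsto (fun y : V => y) F (𝓝 (∑ i, γ i • p i)) := by
      refine Tendsto.congr' hsum (tendsto_finsetSum _ fun i _ => (hγ i).smul (hP i))
    refine hh.2 ⟨∑ i, γ i • p i, funext fun x => ?_⟩
    rw [Horo.internalPoint, spectralDist_zero_left]
    refine tendsto_nhds_unique ?_ (hlim x)
    exact ((continuous_orderUnitNorm.tendsto _).comp (tendsto_const_nhds.sub hy)).sub
      ((continuous_orderUnitNorm.tendsto _).comp hy)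
  set I : Finset (Fin r) := Finset.univ.filter fun i =>
    ∃ b, Tendsto (fun y => orderUnitNorm y - c y i) F (𝓝 b) with hI
  set J : Finset (Fin r) := Finset.univ.filter fun i =>
    ∃ b, Tendsto (fun y => orderUnitNorm y + c y i) F (𝓝 b) with hJ
  -- A common index would make 2ρ = (ρ - c_i) + (ρ + c_i) converge.
  have hdis : Disjoint I J := by
    rw [Finset.disjoint_left]
    intro i h1 h2
    obtain ⟨b1, hb1⟩ := (Finset.mem_filter.1 h1).2
    obtain ⟨b2, hb2⟩ := (Finset.mem_filter.1 h2).2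
    refine not_tendsto_nhds_of_tendsto_atTop (hρ.atTop_add_atTop hρ) (b1 + b2) ?_
    exact (hb1.add hb2).congr fun y => by ring
  have hex1 : ∀ i, ∃ b, i ∈ I → Tendsto (fun y => orderUnitNorm y - c y i) F (𝓝 b) := fun i => by
    by_cases hi : i ∈ I
    · obtain ⟨b, hb⟩ := (Finset.mem_filter.1 hi).2
      exact ⟨b, fun _ => hb⟩
    · exact ⟨0, fun h => absurd h hi⟩
  have hex2 : ∀ i, ∃ b, i ∈ J → Tendsto (fun y => orderUnitNorm y + c y i) F (𝓝 b) := fun i => by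
    by_cases hi : i ∈ J
    · obtain ⟨b, hb⟩ := (Finset.mem_filter.1 hi).2
      exact ⟨b, fun _ => hb⟩
    · exact ⟨0, fun h => absurd h hi⟩
  choose b1 hb1 using hex1
  choose b2 hb2 using hex2
  set α : Fin r → ℝ := fun i => if i ∈ I then b1 i else b2 i with hα
  have hαI : ∀ i ∈ I, Tendsto (fun y => orderUnitNorm y - c y i) F (𝓝 (α i)) := fun i hi => by
    simpa [hα, hi] using hb1 i hi
  have hαJ : ∀ i ∈ J, Tendsto (fun y => orderUnitNorm y + c y i) F (𝓝 (α i)) := fun i hi => by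
    simpa [hα, Finset.disjoint_right.1 hdis hi] using hb2 i hi
  have hαI' : ∀ i ∉ I, Tendsto (fun y => orderUnitNorm y - c y i) F atTop := fun i hi =>
    (hd1 i).resolve_right fun h1 => hi (Finset.mem_filter.2 ⟨Finset.mem_univ i, h1⟩)
  have hαJ' : ∀ i ∉ J, Tendsto (fun y => orderUnitNorm y + c y i) F atTop := fun i hi =>
    (hd2 i).resolve_right fun h1 => hi (Finset.mem_filter.2 ⟨Finset.mem_univ i, h1⟩)
  -- The norm is attained by some |c_i|; the ultrafilter fixes the index and the sign, which gives
  -- the index with α_i = 0. An empty frame is excluded because ρ > 0.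
  have hmax : ∀ᶠ y in F, ∃ i,
      c y i = orderUnitNorm y ∨ c y i = -orderUnitNorm y := by
    filter_upwards [hpa, hsum, hρ.eventually_gt_atTop 0, hc] with y h1 h2 h3 h4
    rcases isEmpty_or_nonempty (Fin r) with hr | hr
    · have h5 := (h1.orderUnitNorm_le_iff (c y) (t := 0)).2 ⟨le_rfl, fun i => hr.elim i⟩
      rw [h2] at h5
      exact absurd h3 (not_lt.2 h5)
    · obtain ⟨i, hi⟩ := Finite.exists_max fun i => |c y i|
      have h5 := (h1.orderUnitNorm_le_iff (c y)).2 ⟨abs_nonneg (c y i), hi⟩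
      rw [h2] at h5
      exact ⟨i, eq_or_eq_neg_of_abs_eq (le_antisymm (h4 i) h5)⟩
  obtain ⟨i, hi⟩ := Ultrafilter.eventually_exists_iff.1 hmax
  have hi0 : i ∈ I ∪ J ∧ α i = 0 := by
    rcases Ultrafilter.eventually_or.1 hi with h1 | h1
    · have h2 : Tendsto (fun y => orderUnitNorm y - c y i) F (𝓝 0) :=
        tendsto_const_nhds.congr' (h1.mono fun y hy => by simp [hy])
      have hiI : i ∈ I := Finset.mem_filter.2 ⟨Finset.mem_univ i, 0, h2⟩
      exact ⟨Finset.mem_union_left _ hiI, tendsto_nhds_unique (hαI i hiI) h2⟩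
    · have h2 : Tendsto (fun y => orderUnitNorm y + c y i) F (𝓝 0) :=
        tendsto_const_nhds.congr' (h1.mono fun y hy => by simp [hy])
      have hiJ : i ∈ J := Finset.mem_filter.2 ⟨Finset.mem_univ i, 0, h2⟩
      exact ⟨Finset.mem_union_right _ hiJ, tendsto_nhds_unique (hαJ i hiJ) h2⟩
  refine ⟨r, p, I, J, α, hp, hdis, ⟨i, hi0.1⟩, ⟨⟨i, hi0.1, hi0.2⟩, ?_⟩, fun x => ?_⟩
  · rintro _ ⟨j, hj, rfl⟩
    rcases Finset.mem_union.1 (Finset.mem_coe.1 hj) with h1 | h1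
    · exact ge_of_tendsto (hαI j h1) (hc1.mono fun y hy => hy j)
    · exact ge_of_tendsto (hαJ j h1) (hc2.mono fun y hy => hy j)
  · refine tendsto_nhds_unique (hlim x) ?_
    refine (tendsto_horoForm F hpa hP hρ hc ⟨i, hi0.1⟩ hαI hαI' hαJ hαJ' x).congr' ?_
    filter_upwards [hsum] with y hy
    rw [hy]

end Norm

/-- The inner product of a Euclidean Jordan algebra. -/
theorem IsEuclideanJordanAlgebra.nonempty_euclideanForm {V : Type*} [NonAssocCommRing V]
    [Module ℝ V] (hV : IsEuclideanJordanAlgebra V) : Nonempty (EuclideanForm V) := by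
  obtain ⟨B, hs, hp, ha⟩ := hV.exists_inner
  refine ⟨⟨{ inner := fun x y => B x y
             conj_inner_symm := fun x y => hs y x
             re_inner_nonneg := fun x => ?_
             add_left := fun x y z => by simp
             smul_left := fun x y c => by simp
             definite := fun x hx => ?_ }, ha⟩⟩
  · by_cases h : x = 0
    · simp [h]
    · exact (hp x h).le
  · by_contra h
    exact (hp x h).ne' hx

end EJA

theorem theorem4p1 {V : Type*} [NonAssocCommRing V] [Module ℝ V] [SMulCommClass ℝ V V]
    [IsScalarTower ℝ V V] (hV : EJA.IsEuclideanJordanAlgebra V) :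
    (∀ (r : ℕ) (p : Fin r → V) (I J : Finset (Fin r)) (α : Fin r → ℝ),
      EJA.IsJordanFrame p → Disjoint I J → (I ∪ J).Nonempty →
      IsLeast (α '' (↑(I ∪ J) : Set (Fin r))) 0 →
      EJA.horoForm p I J α ∈ Horo.boundary (EJA.spectralDist (V := V)) 0) ∧
    (∀ h ∈ Horo.boundary (EJA.spectralDist (V := V)) 0,
      (∃ (r : ℕ) (p : Fin r → V) (I J : Finset (Fin r)) (α : Fin r → ℝ),
        EJA.IsJordanFrame p ∧ Disjoint I J ∧ (I ∪ J).Nonempty ∧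
        IsLeast (α '' (↑(I ∪ J) : Set (Fin r))) 0 ∧
        ∀ x : V, h x = EJA.horoForm p I J α x) ∧
      Horo.IsBusemannPoint (EJA.spectralDist (V := V)) 0 h) := by
  obtain ⟨_⟩ := hV.nonempty_euclideanForm
  have := hV.jordan
  have := hV.finiteDimensional
  refine ⟨fun r p I J α hp hdis hne hα => EJA.horoForm_mem_boundary hp hdis hne hα,
    fun h hh => ?_⟩
  obtain ⟨r, p, I, J, α, hp, hdis, hne, hα, heq⟩ := EJA.exists_horoForm_of_mem_boundary hh
  refine ⟨⟨r, p, I, J, α, hp, hdis, hne, hα, heq⟩, ?_⟩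
  rw [funext heq]
  exact EJA.isBusemannPoint_horoForm hp hdis hne hα
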